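/- **Setting.** Let $\mathbf N=\{1,2,\dots\}$ and let $\mathcal A$ be the ring of column-finite complex matrices $(a_{i,j})_{i,j\in\mathbf N}$ (equivalently, the endomorphism ring of the space of finitely supported columns). Let $\mathcal{DR}_0\subseteq\mathcal A$ be the subring of those $A=(a_{i,j})$ for which there are constants $C,c>0$ with $a_{i,j}=0$ whenever $i>Cj^c$, and $|a_{i,j}|\le Cj^c$ for all $i,j$. Let $S=\begin{pmatrix}0&-1\\1&0\end{pmatrix}$ and $T=\begin{pmatrix}1&1\\0&1\end{pmatrix}$. Define $b_0=b_1=1$ and $b_n=-\sum_{i+j=n,\ i,j\ge1}b_ib_j$ for $n\ge2$ (so $b_n=(-1)^{n-1}\mathrm{Cat}_{n-1}$ for $n\geq 1$), and $g(t)=\sum_{n\ge1}b_nt^n\in\mathbf C[[t]]$, so that $g^2+g=t$. For $X=\sum_n X^{(n)}t^n\in M_2(\mathbf C[[t]])$ let $\gamma^{-1}(X)\in\mathcal A$ be the block upper triangular matrix with $2\times2$ blocks whose $(s,r)$ block ($s,r\ge 0$) is $X^{(r-s)}$ for $s\le r$ and $0$ for $s>r$; $\gamma^{-1}$ is an injective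 ring homomorphism. * $\tau_1:\mathrm{SL}(2,\mathbf Z)\to\mathcal A^\times$ is the representation with $\tau_1(S)=\tilde S=\gamma^{-1}\begin{pmatrix}0&-1\\1&0\end{pmatrix}$ and $\tau_1(T)=\tilde J=\gamma^{-1}\begin{pmatrix}1&1+g(t)\\g(t)&1+t\end{pmatrix}$. * $\tau(Y)=P\tau_1(Y)P^{-1}$, where $P$ is the upper unitriangular matrix whose $n$-th row is the first row of $(\tilde J-I)^{n-1}$. * $\rho(Y)=Z^{-1}\psi(\tau(Y))Z$, where $\psi:\mathcal A\to\mathcal A$ is the ring homomorphism with $\psi(A)_{d2^{k-1},\,d2^{\ell-1}}=A_{k,\ell}$ for $d$ odd and $k,\ell\in\mathbf N$, and $\psi(A)_{i,j}=0$ if $i$ and $j$ have different odd parts; and $Z$ is the upper unitriangular matrix whose $2^kd$-th row ($d$ odd, $k\ge0$) is the $d$-th row of $(D-I)^k$, with $D$ the divisor matrix ($D_{i,j}=1$ if $i\mid j$, and $0$ otherwise). Let $W=\begin{pmatrix}0&1\\1&0\end{pmatrix}\in\mathrm{GL}(2,\mathbf Z)$ and $$W(t)=\frac{1}{\sqrt{t^2+4t+1}}\begin{pmatrix}-t&2g(t)+1\\2g(t)+1&t\end{pmatrix}\in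 M_2(\mathbf C[[t]]),$$ where $1/\sqrt{t^2+4t+1}$ is the power series with constant term $1$ whose square is $(t^2+4t+1)^{-1}$. **Proposition.** 1. $W(t)^2=I$ (so $W(t)\in\mathrm{GL}(2,\mathbf C[[t]])$) and $W(0)=W$; and there is a constant $C$ such that for every entry $w_{i,j}(t)=\sum_n r_nt^n$ of $W(t)$ and every $n\ge0$ one has $|r_n|\le2^{Cn}$. 2. The representation $\rho$ extends to a representation $\rho:\mathrm{GL}(2,\mathbf Z)\to\mathcal{DR}_0^\times$. More precisely, $\tau_1$, $\tau$ and $\rho$ extend to homomorphisms $\tau_1,\tau:\mathrm{GL}(2,\mathbf Z)\to\mathcal A^\times$ and $\rho:\mathrm{GL}(2,\mathbf Z)\to\mathcal{DR}_0^\times$ such that $\tau_1(W)=\gamma^{-1}(W(t))$ and, for all $Y\in\mathrm{GL}(2,\mathbf Z)$, $\tau(Y)=P\tau_1(Y)P^{-1}$ and $\rho(Y)=Z^{-1}\psi(\tau(Y))Z$. 3. For these extensions, none of $\tau_1(Y)$, $\tau(Y)$, $\rho(Y)$ is an integer matrix when $Y\in\mathrm{GL}(2,\mathbf Z)$ has determinant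 $-1$; in particular $\tau_1(W)$, $\tau(W)$ and $\rho(W)$ are not integer matrices. -/

import Mathlib

open scoped PowerSeries MatrixGroups

namespace DivisorMatrix

noncomputable section

/-! ### A homomorphism out of `SL(2, ℤ)` from its standard defining relations -/

section Presentation

variable {H : Type*} [Group H]

/-- The positive words in `T` and `T * S * T = !![1, 0; 1, 1]`, paired with their images. -/
def posWords (s t : H) : Submonoid (SL(2, ℤ) × H) :=
  Submonoid.closure {(ModularGroup.T, t),
    (ModularGroup.T * ModularGroup.S * ModularGroup.T, t * s * t)}

theorem posWords_spec (s t : H) {x : SL(2, ℤ) × H} (hx : x ∈ posWords s t) :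
    (1 ≤ x.1.1 0 0 ∧ 0 ≤ x.1.1 0 1 ∧ 0 ≤ x.1.1 1 0 ∧ 1 ≤ x.1.1 1 1) ∧
      (x.1.1 0 1 = 0 → x.1.1 1 0 = 0 → x.2 = 1) := by
  induction hx using Submonoid.closure_induction_left with
  | one => simp
  | mul_left y hy z hz ih =>
    obtain ⟨⟨h1, h2, h3, h4⟩, h5⟩ := ih
    rcases hy with rfl | rfl <;>
    · simp only [Prod.fst_mul, Prod.snd_mul, Matrix.SpecialLinearGroup.coe_mul,
        ModularGroup.coe_T, ModularGroup.coe_S, Matrix.mul_apply, Fin.sum_univ_two,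
        Matrix.of_apply, Matrix.cons_val', Matrix.cons_val_zero, Matrix.cons_val_one,
        Matrix.cons_val_fin_one]
      refine ⟨⟨by omega, by omega, by omega, by omega⟩, fun h h' => by omega⟩

/-- Normal forms `± R ^ e * M * S ^ b` with `M` a positive word and `R = S * T`. -/
def IsNormalForm (s t : H) (x : SL(2, ℤ) × H) : Prop :=
  ∃ a e b : ℕ, e < 3 ∧ b < 2 ∧ ∃ m ∈ posWords s t,
    x = ((ModularGroup.S, s) ^ 2) ^ a * ((ModularGroup.S, s) * (ModularGroup.T, t)) ^ e * m *
      (ModularGroup.S, s) ^ b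

theorem isNormalForm_closure {s t : H} (h1 : s ^ 4 = 1) (h3 : s ^ 2 = (s * t) ^ 3)
    {x : SL(2, ℤ) × H}
    (hx : x ∈ Subgroup.closure {((ModularGroup.S, s) : SL(2, ℤ) × H), (ModularGroup.T, t)}) :
    IsNormalForm s t x := by
  have e1 : ((ModularGroup.S, s) : SL(2, ℤ) × H) ^ 4 = 1 :=
    Prod.ext (by simp only [Prod.pow_mk, Prod.fst_one]; decide) h1
  have e3 : ((ModularGroup.S, s) : SL(2, ℤ) × H) ^ 2 =
      ((ModularGroup.S, s) * (ModularGroup.T, t)) ^ 3 :=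
    Prod.ext (by simp only [Prod.pow_mk, Prod.mk_mul_mk]; decide) h3
  unfold IsNormalForm
  have hT : (ModularGroup.T, t) ∈ posWords s t := Submonoid.subset_closure (by simp)
  have hL : ((ModularGroup.T, t) * (ModularGroup.S, s) * (ModularGroup.T, t) : SL(2, ℤ) × H) ∈
    posWords s t := Submonoid.subset_closure (by simp)
  have hcases : ∀ m ∈ posWords s t, m = 1 ∨ ∃ m' ∈ posWords s t, m = (ModularGroup.T, t) * m' ∨
      m = (ModularGroup.T, t) * (ModularGroup.S, s) * (ModularGroup.T, t) * m' := by
    intro m hm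
    induction hm using Submonoid.closure_induction_left with
    | one => exact Or.inl rfl
    | mul_left y hy z hz _ =>
      refine Or.inr ⟨z, hz, ?_⟩
      rcases hy with rfl | rfl
      · exact Or.inl rfl
      · exact Or.inr rfl
  generalize ((ModularGroup.S, s) : SL(2, ℤ) × H) = σ at *
  generalize ((ModularGroup.T, t) : SL(2, ℤ) × H) = θ at *
  generalize posWords s t = N at *
  set NF : SL(2, ℤ) × H → Prop := fun x => ∃ a e b : ℕ, e < 3 ∧ b < 2 ∧ ∃ m ∈ N,
    x = (σ ^ 2) ^ a * (σ * θ) ^ e * m * σ ^ b with hNF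
  have cσ : ∀ a, Commute σ ((σ ^ 2) ^ a) := fun a => ((Commute.refl σ).pow_right 2).pow_right a
  have cρ : ∀ a, Commute (σ * θ) ((σ ^ 2) ^ a) := fun a => by
    rw [e3]; exact ((Commute.refl _).pow_right 3).pow_right a
  have Kz : ∀ x, NF x → NF (σ ^ 2 * x) := by
    rintro x ⟨a, e, b, he, hb, m, hm, rfl⟩
    exact ⟨a + 1, e, b, he, hb, m, hm, by rw [pow_succ' (σ ^ 2) a]; group⟩
  have Kσ : ∀ x, NF x → NF (σ * x) := by
    rintro x ⟨a, e, b, he, hb, m, hm, rfl⟩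
    have key : σ * ((σ ^ 2) ^ a * (σ * θ) ^ e * m * σ ^ b) =
      (σ ^ 2) ^ a * (σ * ((σ * θ) ^ e * m * σ ^ b)) := by
      simp only [← mul_assoc, (cσ a).eq]
    rw [key]
    interval_cases e
    · rcases hcases m hm with rfl | ⟨m', hm', rfl | rfl⟩
      · interval_cases b
        · exact ⟨a, 0, 1, by omega, by omega, 1, hm, by simp⟩
        · exact ⟨a + 1, 0, 0, by omega, by omega, 1, hm, by simp [pow_succ]⟩
      · exact ⟨a, 1, b, by omega, hb, m', hm', by simp [mul_assoc]⟩
      · exact ⟨a, 2, b, by omega, hb, m', hm', by simp [mul_assoc, pow_two (σ * θ)]⟩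
    · exact ⟨a + 1, 0, b, by omega, hb, θ * m, N.mul_mem hT hm, by
        rw [pow_succ (σ ^ 2) a]
        simp only [pow_two, pow_one, pow_zero, mul_one, mul_assoc]⟩
    · exact ⟨a + 1, 0, b, by omega, hb, θ * σ * θ * m, N.mul_mem hL hm, by
        rw [pow_succ (σ ^ 2) a]
        simp only [pow_two, pow_zero, mul_one, mul_assoc]⟩
  have Kρ : ∀ x, NF x → NF (σ * θ * x) := by
    rintro x ⟨a, e, b, he, hb, m, hm, rfl⟩
    have key : σ * θ * ((σ ^ 2) ^ a * (σ * θ) ^ e * m * σ ^ b) =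
      (σ ^ 2) ^ a * ((σ * θ) ^ (e + 1) * m * σ ^ b) := by
      rw [pow_succ' (σ * θ) e]
      simp only [← mul_assoc]
      have := (cρ a).eq
      simp only [← mul_assoc] at this
      rw [this]
    rw [key]
    by_cases h : e = 2
    · subst h
      refine ⟨a + 1, 0, b, by omega, hb, m, hm, ?_⟩
      rw [show 2 + 1 = 3 from rfl, ← e3, pow_succ (σ ^ 2) a]
      simp [mul_assoc]
    · exact ⟨a, e + 1, b, by omega, hb, m, hm, by simp [mul_assoc]⟩
  have iσ : σ⁻¹ = σ ^ 2 * σ := by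
    rw [inv_eq_iff_mul_eq_one, ← pow_succ, ← pow_succ', e1]
  have iρ : (σ * θ)⁻¹ = σ ^ 2 * ((σ * θ) * (σ * θ)) := by
    rw [inv_eq_iff_mul_eq_one, e3, ← pow_two, ← pow_add, ← pow_succ', show 3 + 2 + 1 = 3 * 2 from rfl,
      pow_mul, ← e3, ← pow_mul, e1]
  have Kσ' : ∀ x, NF x → NF (σ⁻¹ * x) := fun x hx => by
    rw [iσ, mul_assoc]; exact Kz _ (Kσ _ hx)
  have Kρ' : ∀ x, NF x → NF ((σ * θ)⁻¹ * x) := fun x hx => by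
    rw [iρ, mul_assoc, mul_assoc]; exact Kz _ (Kρ _ (Kρ _ hx))
  induction hx using Subgroup.closure_induction_left with
  | one => exact ⟨0, 0, 0, by omega, by omega, 1, N.one_mem, by simp⟩
  | mul_left y hy z hz ih =>
    rcases hy with rfl | rfl
    · exact Kσ _ ih
    · have := Kσ' _ (Kρ _ ih)
      rwa [mul_assoc, inv_mul_cancel_left] at this
  | inv_mul_cancel y hy z hz ih =>
    rcases hy with rfl | rfl
    · exact Kσ' _ ih
    · have := Kρ' _ (Kσ _ ih)
      rwa [mul_inv_rev, mul_assoc, inv_mul_cancel_left] at this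

theorem eq_one_of_mem_closure {s t : H} (h1 : s ^ 4 = 1) (h3 : s ^ 2 = (s * t) ^ 3) {h : H}
    (hx : ((1, h) : SL(2, ℤ) × H) ∈
      Subgroup.closure {((ModularGroup.S, s) : SL(2, ℤ) × H), (ModularGroup.T, t)}) : h = 1 := by
  obtain ⟨a, e, b, he, hb, m, hm, hxe⟩ := isNormalForm_closure h1 h3 hx
  obtain ⟨⟨p1, p2, p3, p4⟩, p5⟩ := posWords_spec s t hm
  have hpar : ((ModularGroup.S, s) ^ 2) ^ a = (1 : SL(2, ℤ) × H) ∨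
      ((ModularGroup.S, s) ^ 2) ^ a = ((ModularGroup.S, s) : SL(2, ℤ) × H) ^ 2 := by
    have e1 : (((ModularGroup.S, s) : SL(2, ℤ) × H) ^ 2) ^ 2 = 1 :=
      Prod.ext (by simp only [Prod.pow_mk, Prod.fst_one]; decide)
        (by simpa [← pow_mul] using h1)
    rcases Nat.even_or_odd' a with ⟨k, rfl | rfl⟩
    · left; rw [pow_mul, e1, one_pow]
    · right; rw [pow_succ, pow_mul, e1, one_pow, one_mul]
  have hfst : ∀ i j, ((1 : SL(2, ℤ)) : Matrix (Fin 2) (Fin 2) ℤ) i j =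
    ((((ModularGroup.S, s) ^ 2) ^ a * ((ModularGroup.S, s) * (ModularGroup.T, t)) ^ e * m *
      (ModularGroup.S, s) ^ b : SL(2, ℤ) × H).1 : Matrix (Fin 2) (Fin 2) ℤ) i j :=
    fun i j => by rw [← hxe]
  have hsnd := congrArg Prod.snd hxe
  have q00 := hfst 0 0
  have q01 := hfst 0 1
  have q10 := hfst 1 0
  have q11 := hfst 1 1
  rcases hpar with hp | hp <;> rw [hp] at q00 q01 q10 q11 hsnd <;>
    interval_cases e <;> interval_cases b <;>
    simp only [pow_two, pow_zero, pow_one, one_mul, mul_one, Prod.fst_mul, Prod.snd_mul,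
      Matrix.SpecialLinearGroup.coe_mul, Matrix.SpecialLinearGroup.coe_one, Matrix.one_apply,
      Matrix.mul_apply, Fin.sum_univ_two, ModularGroup.coe_T, ModularGroup.coe_S,
      Matrix.of_apply, Matrix.cons_val', Matrix.cons_val_zero, Matrix.cons_val_one,
      Matrix.cons_val_fin_one, if_true, zero_ne_one, one_ne_zero, if_false]
      at q00 q01 q10 q11 hsnd <;>
    first
    | omega
    | (rw [hsnd]; exact p5 (by omega) (by omega))

theorem exists_lift (s t : H) (h1 : s ^ 4 = 1) (h3 : s ^ 2 = (s * t) ^ 3) :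
    ∃ f : SL(2, ℤ) →* H, f ModularGroup.S = s ∧ f ModularGroup.T = t := by
  set Γ := Subgroup.closure {((ModularGroup.S, s) : SL(2, ℤ) × H), (ModularGroup.T, t)} with hΓ
  have hS : (ModularGroup.S, s) ∈ Γ := Subgroup.subset_closure (by simp)
  have hT : (ModularGroup.T, t) ∈ Γ := Subgroup.subset_closure (by simp)
  have hsurj : ∀ y : SL(2, ℤ), ∃ h, (y, h) ∈ Γ := by
    intro y
    have hy : y ∈ Subgroup.closure {ModularGroup.S, ModularGroup.T} := by
      rw [SpecialLinearGroup.SL2Z_generators]; trivial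
    have hle : Subgroup.closure {ModularGroup.S, ModularGroup.T} ≤
        Γ.map (MonoidHom.fst (SL(2, ℤ)) H) := by
      rw [Subgroup.closure_le]
      rintro _ (rfl | rfl)
      · exact ⟨_, hS, rfl⟩
      · exact ⟨_, hT, rfl⟩
    obtain ⟨x, hx, rfl⟩ := hle hy
    exact ⟨x.2, hx⟩
  have huniq : ∀ {y h h'}, (y, h) ∈ Γ → (y, h') ∈ Γ → h = h' := by
    intro y h h' hh hh'
    have := Γ.mul_mem hh (Γ.inv_mem hh')
    rw [Prod.inv_mk, Prod.mk_mul_mk, mul_inv_cancel] at this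
    exact mul_inv_eq_one.mp (eq_one_of_mem_closure h1 h3 this)
  choose f hf using hsurj
  exact ⟨MonoidHom.mk' f fun x y => huniq (hf _) (Γ.mul_mem (hf x) (hf y)),
    huniq (hf _) hS, huniq (hf _) hT⟩

/-- The homomorphism `SL(2, ℤ) → H` with `S ↦ s` and `T ↦ t`, for `s`, `t` satisfying the standard
defining relations. It is unique, as `S` and `T` generate `SL(2, ℤ)`. -/
def liftSL (s t : H) (h1 : s ^ 4 = 1) (h3 : s ^ 2 = (s * t) ^ 3) : SL(2, ℤ) →* H :=
  (exists_lift s t h1 h3).choose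

theorem liftSL_S (s t : H) (h1 : s ^ 4 = 1) (h3 : s ^ 2 = (s * t) ^ 3) :
    liftSL s t h1 h3 ModularGroup.S = s :=
  (exists_lift s t h1 h3).choose_spec.1

theorem liftSL_T (s t : H) (h1 : s ^ 4 = 1) (h3 : s ^ 2 = (s * t) ^ 3) :
    liftSL s t h1 h3 ModularGroup.T = t :=
  (exists_lift s t h1 h3).choose_spec.2

end Presentation

/-! ### The ring of column-finite matrices -/

/-- The ring of endomorphisms of the space `E` of finitely supported columns indexed by the
positive integers, i.e. of column-finite complex matrices. -/
abbrev ColFin : Type := Module.End ℂ (ℕ+ →₀ ℂ)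

/-- The `(i, j)` entry of the matrix of `A` in the standard basis. -/
def entry (A : ColFin) (i j : ℕ+) : ℂ := A (Finsupp.single j 1) i

/-- The endomorphism with a given column-finite matrix. -/
def ofMatrix (a : ℕ+ → ℕ+ → ℂ) (h : ∀ j, (Function.support fun i => a i j).Finite) : ColFin :=
  Finsupp.linearCombination ℂ fun j => Finsupp.ofSupportFinite (fun i => a i j) (h j)

@[simp] theorem entry_ofMatrix (a : ℕ+ → ℕ+ → ℂ) (h) (i j : ℕ+) :
    entry (ofMatrix a h) i j = a i j := by
  simp only [entry, ofMatrix, Finsupp.linearCombination_single, one_smul]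
  rfl

theorem ext_entry {A B : ColFin} (h : ∀ i j, entry A i j = entry B i j) : A = B := by
  refine Finsupp.lhom_ext' fun j => LinearMap.ext_ring ?_
  ext i
  exact h i j

theorem apply_eq_sum (A : ColFin) (v : ℕ+ →₀ ℂ) (i : ℕ+) {s : Finset ℕ+} (hs : v.support ⊆ s) :
    A v i = ∑ m ∈ s, entry A i m * v m := by
  have hv : v = ∑ m ∈ s, v m • Finsupp.single m (1 : ℂ) := by
    conv_lhs => rw [← Finsupp.sum_single v]
    rw [Finsupp.sum_of_support_subset _ hs _ (by simp)]
    simp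
  conv_lhs => rw [hv]
  rw [map_sum, Finsupp.finsetSum_apply]
  refine Finset.sum_congr rfl fun m _ => ?_
  rw [map_smul, Finsupp.smul_apply, smul_eq_mul, mul_comm]
  rfl

theorem entry_mul (A B : ColFin) (i j : ℕ+) {s : Finset ℕ+}
    (hs : ∀ m, entry B m j ≠ 0 → m ∈ s) :
    entry (A * B) i j = ∑ m ∈ s, entry A i m * entry B m j :=
  apply_eq_sum A (B (Finsupp.single j 1)) i fun m hm => hs m (Finsupp.mem_support_iff.mp hm)

theorem entry_one (i j : ℕ+) : entry 1 i j = if i = j then 1 else 0 := by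
  simp [entry, Finsupp.single_apply, eq_comm]

theorem entry_zero (i j : ℕ+) : entry 0 i j = 0 := rfl

theorem entry_add (A B : ColFin) (i j : ℕ+) : entry (A + B) i j = entry A i j + entry B i j := rfl

theorem entry_neg (A : ColFin) (i j : ℕ+) : entry (-A) i j = -entry A i j := rfl

theorem entry_sub (A B : ColFin) (i j : ℕ+) : entry (A - B) i j = entry A i j - entry B i j := by
  simp [entry]

/-- A column-finite matrix all of whose entries are (rational) integers. -/
def IsIntegerMatrix (A : ColFin) : Prop := ∀ i j, ∃ n : ℤ, entry A i j = n

/-! ### The ring `DR₀` -/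

/-- The polynomial growth conditions defining `DR₀`. -/
def PolyGrowth (A : ColFin) : Prop :=
  ∃ C c : ℝ, 0 < C ∧ 0 < c ∧
    (∀ i j : ℕ+, (i : ℝ) > C * (j : ℝ) ^ c → entry A i j = 0) ∧
    (∀ i j : ℕ+, ‖entry A i j‖ ≤ C * (j : ℝ) ^ c)

theorem one_le_cast (j : ℕ+) : (1 : ℝ) ≤ (j : ℝ) := by exact_mod_cast (one_le : 1 ≤ j)

/-- In the growth conditions one may take a single natural number, as large as desired, for both
constants. -/
theorem polyGrowth_iff (A : ColFin) : PolyGrowth A ↔ ∃ K₀ : ℕ, ∀ K : ℕ, K₀ ≤ K →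
    (∀ i j : ℕ+, entry A i j ≠ 0 → (i : ℝ) ≤ K * (j : ℝ) ^ K) ∧
    (∀ i j : ℕ+, ‖entry A i j‖ ≤ K * (j : ℝ) ^ K) := by
  constructor
  · rintro ⟨C, c, hC, hc, h1, h2⟩
    obtain ⟨K₀, hK⟩ := exists_nat_ge (max C c)
    refine ⟨K₀, fun K hKK => ?_⟩
    have hK' : (K₀ : ℝ) ≤ K := by exact_mod_cast hKK
    have key : ∀ j : ℕ+, C * (j : ℝ) ^ c ≤ K * (j : ℝ) ^ K := fun j => by
      rw [← Real.rpow_natCast]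
      have := one_le_cast j
      have := (le_max_left C c).trans (hK.trans hK')
      have := (le_max_right C c).trans (hK.trans hK')
      gcongr
    exact ⟨fun i j hij => (not_lt.mp fun h => hij (h1 i j h)).trans (key j),
      fun i j => (h2 i j).trans (key j)⟩
  · rintro ⟨K₀, hK⟩
    obtain ⟨h1, h2⟩ := hK (K₀ + 1) (by omega)
    refine ⟨(K₀ + 1 : ℕ), (K₀ + 1 : ℕ), by positivity, by positivity, ?_, ?_⟩
    · intro i j hij
      rw [Real.rpow_natCast] at hij
      by_contra h
      exact absurd (h1 i j h) (not_le.mpr hij)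
    · intro i j
      rw [Real.rpow_natCast]
      exact h2 i j

theorem PolyGrowth.mul {A B : ColFin} (hA : PolyGrowth A) (hB : PolyGrowth B) :
    PolyGrowth (A * B) := by
  rw [polyGrowth_iff] at hA hB
  obtain ⟨KA, hA⟩ := hA
  obtain ⟨KB, hB⟩ := hB
  set K := max KA KB + 1 with hKdef
  obtain ⟨a1, a2⟩ := hA K (by omega)
  obtain ⟨b1, b2⟩ := hB K (by omega)
  have hK1 : (1 : ℝ) ≤ K := by exact_mod_cast Nat.le_add_left 1 _
  have hex : ∀ j : ℕ+, ∃ M : ℕ+, (M : ℕ) = K * (j : ℕ) ^ K := fun j =>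
    ⟨⟨K * (j : ℕ) ^ K, by positivity⟩, rfl⟩
  choose M hM using hex
  have hsupp : ∀ j m : ℕ+, entry B m j ≠ 0 →
      m ∈ Finset.Icc 1 (M j) := fun j m hm => by
    rw [Finset.mem_Icc]
    refine ⟨one_le, ?_⟩
    rw [← PNat.coe_le_coe, hM]
    exact_mod_cast b1 m j hm
  have hpow : ∀ j m : ℕ+, (m : ℝ) ≤ K * (j : ℝ) ^ K →
      (K : ℝ) * (m : ℝ) ^ K ≤ K ^ (K + 1) * (j : ℝ) ^ (K * K) := fun j m hm => by
    calc (K : ℝ) * (m : ℝ) ^ K ≤ K * (K * (j : ℝ) ^ K) ^ K := by gcongr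
      _ = _ := by ring
  refine ⟨(K : ℝ) ^ (K + 3), ((K * K + 2 * K : ℕ) : ℝ), by positivity, by positivity, ?_, ?_⟩
  · intro i j hij
    rw [Real.rpow_natCast] at hij
    rw [entry_mul A B i j (hsupp j)]
    refine Finset.sum_eq_zero fun m _ => ?_
    by_contra hne
    have hAm := a1 i m (left_ne_zero_of_mul hne)
    have hBm := b1 m j (right_ne_zero_of_mul hne)
    refine absurd (hAm.trans (hpow j m hBm)) (not_le.mpr (lt_of_le_of_lt ?_ hij))
    have := one_le_cast j
    gcongr <;> omega
  · intro i j
    rw [Real.rpow_natCast, entry_mul A B i j (hsupp j)]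
    have hterm : ∀ m ∈ Finset.Icc 1 (M j),
        ‖entry A i m * entry B m j‖ ≤ K ^ (K + 1) * (j : ℝ) ^ (K * K) * (K * (j : ℝ) ^ K) := by
      intro m hm
      rw [norm_mul]
      have hm' : (m : ℝ) ≤ K * (j : ℝ) ^ K := by
        have := (Finset.mem_Icc.mp hm).2
        rw [← PNat.coe_le_coe, hM] at this
        exact_mod_cast this
      exact mul_le_mul ((a2 i m).trans (hpow j m hm')) (b2 m j) (norm_nonneg _) (by positivity)
    refine (norm_sum_le_of_le _ hterm).trans (le_of_eq ?_)
    rw [Finset.sum_const, PNat.card_Icc]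
    simp only [hM, PNat.one_coe, add_tsub_cancel_right, nsmul_eq_mul]
    push_cast
    ring

theorem PolyGrowth.add {A B : ColFin} (hA : PolyGrowth A) (hB : PolyGrowth B) :
    PolyGrowth (A + B) := by
  rw [polyGrowth_iff] at hA hB
  obtain ⟨KA, hA⟩ := hA
  obtain ⟨KB, hB⟩ := hB
  set K := max KA KB + 1 with hKdef
  obtain ⟨a1, a2⟩ := hA K (by omega)
  obtain ⟨b1, b2⟩ := hB K (by omega)
  have hK1 : (0 : ℝ) < K := by rw [hKdef]; positivity
  refine ⟨2 * K, K, by positivity, hK1, ?_, ?_⟩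
  · intro i j hij
    rw [Real.rpow_natCast] at hij
    have hlt : (K : ℝ) * (j : ℝ) ^ K < i := by
      have : (0 : ℝ) ≤ K * (j : ℝ) ^ K := by positivity
      linarith
    rw [entry_add]
    have hA0 : entry A i j = 0 := by
      by_contra h
      exact absurd (a1 i j h) (not_le.mpr hlt)
    have hB0 : entry B i j = 0 := by
      by_contra h
      exact absurd (b1 i j h) (not_le.mpr hlt)
    rw [hA0, hB0, add_zero]
  · intro i j
    rw [Real.rpow_natCast, entry_add]
    linarith [norm_add_le (entry A i j) (entry B i j), a2 i j, b2 i j]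

/-- The ring `DR₀` of column-finite matrices satisfying the polynomial growth conditions. -/
def DR0 : Subring ColFin where
  carrier := {A | PolyGrowth A}
  mul_mem' := PolyGrowth.mul
  one_mem' := by
    refine ⟨1, 1, one_pos, one_pos, fun i j hij => ?_, fun i j => ?_⟩
    · rw [entry_one, if_neg]
      rintro rfl
      simp at hij
    · rw [entry_one, Real.rpow_one, one_mul]
      have := one_le_cast j
      split_ifs
      · rw [norm_one]; exact this
      · rw [norm_zero]; linarith
  add_mem' := PolyGrowth.add
  zero_mem' := ⟨1, 1, one_pos, one_pos, fun _ _ _ => rfl, fun i j => by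
    rw [entry_zero, norm_zero]; positivity⟩
  neg_mem' := by
    rintro A ⟨C, c, hC, hc, h1, h2⟩
    exact ⟨C, c, hC, hc, fun i j hij => by rw [entry_neg, h1 i j hij, neg_zero],
      fun i j => by rw [entry_neg, norm_neg]; exact h2 i j⟩

/-! ### Upper unitriangular matrices -/

/-- A matrix with zeros below the diagonal and ones on the diagonal. -/
def IsUpperUnitriangular (a : ℕ+ → ℕ+ → ℂ) : Prop :=
  (∀ i j, j < i → a i j = 0) ∧ ∀ i, a i i = 1

theorem IsUpperUnitriangular.finite {a : ℕ+ → ℕ+ → ℂ} (h : IsUpperUnitriangular a) (j : ℕ+) :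
    (Function.support fun i => a i j).Finite :=
  (Set.finite_Iic j).subset fun i hi => by
    by_contra hij
    exact hi (h.1 i j (not_le.mp hij))

theorem IsUpperUnitriangular.isUnit {a : ℕ+ → ℕ+ → ℂ} (h : IsUpperUnitriangular a) :
    IsUnit (ofMatrix a h.finite) := by
  rw [Module.End.isUnit_iff]
  constructor
  · rw [injective_iff_map_eq_zero]
    intro v hv
    by_contra hne
    have hne' : v.support.Nonempty := Finsupp.support_nonempty_iff.mpr hne
    set m := v.support.max' hne' with hm
    have hmem : m ∈ v.support := Finset.max'_mem _ _
    have h0 : ofMatrix a h.finite v m = 0 := by rw [hv]; rfl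
    rw [apply_eq_sum _ v m subset_rfl, Finset.sum_eq_single_of_mem m hmem] at h0
    · rw [entry_ofMatrix, h.2, one_mul] at h0
      exact Finsupp.mem_support_iff.mp hmem h0
    · intro k hk hkm
      have : k < m := lt_of_le_of_ne (Finset.le_max' _ _ hk) hkm
      rw [entry_ofMatrix, h.1 _ _ this, zero_mul]
  · rw [← LinearMap.range_eq_top, eq_top_iff, ← Finsupp.span_single_eq_top, Submodule.span_le]
    have key : ∀ j : ℕ+, Finsupp.single j (1 : ℂ) ∈ LinearMap.range (ofMatrix a h.finite) := by
      intro j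
      induction j using PNat.strongInductionOn with
      | _ j ih =>
        have hj : Finsupp.single j (1 : ℂ) = ofMatrix a h.finite (Finsupp.single j 1) -
            ∑ m ∈ Finset.Iio j, a m j • Finsupp.single m (1 : ℂ) := by
          ext i
          have he : ofMatrix a h.finite (Finsupp.single j 1) i = a i j := entry_ofMatrix a _ i j
          rw [Finsupp.sub_apply, he, Finsupp.finsetSum_apply]
          simp only [Finsupp.smul_apply, Finsupp.single_apply, smul_eq_mul, mul_ite, mul_one,
            mul_zero, Finset.sum_ite_eq', Finset.mem_Iio]
          rcases lt_trichotomy i j with hij | rfl | hij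
          · rw [if_neg hij.ne', if_pos hij, sub_self]
          · rw [if_pos rfl, if_neg (lt_irrefl _), h.2, sub_zero]
          · rw [if_neg hij.ne, if_neg hij.not_gt, h.1 i j hij, sub_zero]
        rw [hj]
        exact Submodule.sub_mem _ (LinearMap.mem_range_self _ _)
          (Submodule.sum_mem _ fun m hm => Submodule.smul_mem _ _ (ih m (Finset.mem_Iio.mp hm)))
    rintro _ ⟨j, x, rfl⟩
    have := Submodule.smul_mem _ x (key j)
    rwa [Finsupp.smul_single, smul_eq_mul, mul_one] at this

/-- An upper unitriangular matrix, as a unit of the ring of column-finite matrices. -/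
def unitOfUpper (a : ℕ+ → ℕ+ → ℂ) (h : IsUpperUnitriangular a) : ColFinˣ := h.isUnit.unit

/-- Rows of powers: if `N i j = 0` for `j < f i` and `N i (f i) = 1`, with `f` strictly increasing,
then row `d` of `N ^ k` starts with an entry `1` in column `f^[k] d`. -/
theorem entry_pow {N : ColFin} {f : ℕ+ → ℕ+} (hf : StrictMono f)
    (h0 : ∀ i j, j < f i → entry N i j = 0) (h1 : ∀ i, entry N i (f i) = 1) (k : ℕ) (d : ℕ+) :
    (∀ j, j < f^[k] d → entry (N ^ k) d j = 0) ∧ entry (N ^ k) d (f^[k] d) = 1 := by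
  induction k with
  | zero => 
    refine ⟨fun j hj => ?_, ?_⟩
    · rw [pow_zero, entry_one, if_neg (by rintro rfl; simp at hj)]
    · rw [pow_zero, entry_one]; simp
  | succ k ih =>
    obtain ⟨ih0, ih1⟩ := ih
    have hcol : ∀ j m, entry N m j ≠ 0 → m ∈ Finset.Icc 1 j := fun j m hm => by
      rw [Finset.mem_Icc]
      refine ⟨one_le, ?_⟩
      by_contra hlt
      exact hm (h0 m j ((not_le.mp hlt).trans_le (hf.id_le m)))
    have hterm : ∀ j m, m ≠ f^[k] d → j ≤ f (f^[k] d) →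
        entry (N ^ k) d m * entry N m j = 0 := fun j m hm hj => by
      rcases lt_or_gt_of_ne hm with hlt | hgt
      · rw [ih0 m hlt, zero_mul]
      · rw [h0 m j (hj.trans_lt (hf hgt)), mul_zero]
    rw [Function.iterate_succ_apply', pow_succ]
    refine ⟨fun j hj => ?_, ?_⟩
    · rw [entry_mul _ _ _ _ (hcol j)]
      refine Finset.sum_eq_zero fun m _ => ?_
      by_cases hm : m = f^[k] d
      · rw [hm, h0 _ _ hj, mul_zero]
      · exact hterm j m hm hj.le
    · rw [entry_mul _ _ _ _ (hcol _), Finset.sum_eq_single_of_mem (f^[k] d)]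
      · rw [ih1, h1, one_mul]
      · exact hcol _ _ (by rw [h1]; exact one_ne_zero)
      · exact fun m _ hm => hterm _ m hm le_rfl

/-! ### The divisor matrix and its transition matrix `Z` -/

/-- The divisor matrix `D`. -/
def divisorMatrix : ColFin :=
  ofMatrix (fun i j => if (i : ℕ) ∣ (j : ℕ) then 1 else 0) fun j =>
    (Set.finite_Iic j).subset fun i hi => by
      by_contra hij
      exact hi (if_neg fun hd => hij (Nat.le_of_dvd j.pos hd))

/-- The exponent of the highest power of `2` dividing `i`. -/
def v2 (i : ℕ+) : ℕ := (i : ℕ).factorization 2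

/-- The odd part of `i`, so that `i = oddPart i * 2 ^ v2 i`. -/
def oddPart (i : ℕ+) : ℕ+ := ⟨(i : ℕ) / 2 ^ v2 i, Nat.ordCompl_pos 2 i.ne_zero⟩

theorem oddPart_mul (i : ℕ+) : oddPart i * 2 ^ v2 i = i := by
  apply PNat.coe_injective
  rw [PNat.mul_coe, PNat.pow_coe]
  exact Nat.div_mul_cancel (Nat.ordProj_dvd (i : ℕ) 2)

theorem eq_of_oddPart_eq {i j : ℕ+} (h : oddPart i = oddPart j) (h' : v2 i = v2 j) : i = j := by
  rw [← oddPart_mul i, ← oddPart_mul j, h, h']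

theorem exists_oddPart_v2 (i : ℕ+) (k : ℕ) : ∃ m, oddPart m = oddPart i ∧ v2 m = k := by
  have hodd : ¬ 2 ∣ (oddPart i : ℕ) := Nat.not_dvd_ordCompl Nat.prime_two i.ne_zero
  have hv : v2 (oddPart i * 2 ^ k) = k := by
    unfold v2
    rw [PNat.mul_coe, PNat.pow_coe, Nat.factorization_mul (oddPart i).ne_zero (by positivity)]
    simp [Nat.factorization_eq_zero_of_not_dvd hodd, Nat.prime_two.factorization_self]
  refine ⟨oddPart i * 2 ^ k, ?_, hv⟩
  have := oddPart_mul (oddPart i * 2 ^ k)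
  rw [hv] at this
  exact mul_right_cancel this

/-- The entries of `Z`: if `i = 2 ^ k * d` with `d` odd, the `i`-th row of `Z` is the `d`-th row of
`(D - 1) ^ k`. -/
def zEntry (i j : ℕ+) : ℂ := entry ((divisorMatrix - 1) ^ v2 i) (oddPart i) j

theorem zEntry_upper : IsUpperUnitriangular zEntry := by
  have hf : StrictMono fun i : ℕ+ => i * 2 := fun i j hij => mul_lt_mul_left hij 2
  have h0 : ∀ i j : ℕ+, j < i * 2 → entry (divisorMatrix - 1) i j = 0 := by
    intro i j hij
    rw [entry_sub, entry_one, divisorMatrix, entry_ofMatrix]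
    by_cases h : i = j
    · rw [if_pos h, if_pos (by rw [h]), sub_self]
    · rw [if_neg h, if_neg, sub_self]
      rw [← PNat.dvd_iff]
      rintro ⟨c, rfl⟩
      have hc : c < 2 := lt_of_mul_lt_mul_left' hij
      have : c = 1 := by
        apply PNat.coe_injective
        have h2 : (c : ℕ) < 2 := hc
        have := c.pos
        rw [PNat.one_coe]
        omega
      exact h (by rw [this, mul_one])
  have h1 : ∀ i : ℕ+, entry (divisorMatrix - 1) i (i * 2) = 1 := by
    intro i
    rw [entry_sub, entry_one, divisorMatrix, entry_ofMatrix, if_pos (PNat.dvd_iff.mp (Dvd.intro _ rfl)), if_neg,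
      sub_zero]
    intro h
    have := congrArg PNat.val h
    have hi := i.pos
    have h2 : ((i * 2 : ℕ+) : ℕ) = i * 2 := PNat.mul_coe i 2
    change (i : ℕ) = ((i * 2 : ℕ+) : ℕ) at this
    omega
  have hit : ∀ i : ℕ+, (fun i : ℕ+ => i * 2)^[v2 i] (oddPart i) = i := by
    intro i
    rw [mul_right_iterate]
    exact oddPart_mul i
  refine ⟨fun i j hij => ?_, fun i => ?_⟩
  · exact (entry_pow hf h0 h1 (v2 i) (oddPart i)).1 j (by rwa [hit])
  · have := (entry_pow hf h0 h1 (v2 i) (oddPart i)).2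
    rwa [hit] at this

/-- The matrix `Z`. -/
def matZ : ColFinˣ := unitOfUpper zEntry zEntry_upper

/-! ### Block Toeplitz matrices and matrices of power series -/

/-- The `2 × 2` block containing an index (blocks are numbered from `0`), and the position in it:
`2 * s + 1 ↦ (s, 0)` and `2 * s + 2 ↦ (s, 1)`. -/
def blockIndex : ℕ+ ≃ ℕ × Fin 2 := Equiv.pnatEquivNat.trans (Nat.divModEquiv 2)

theorem coe_eq_blockIndex (i : ℕ+) :
    (i : ℕ) = 2 * (blockIndex i).1 + ((blockIndex i).2 : ℕ) + 1 := by
  have h : (blockIndex i).1 = i.natPred / 2 ∧ ((blockIndex i).2 : ℕ) = i.natPred % 2 := by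
    simp [blockIndex, Nat.divModEquiv]
  have := PNat.natPred_add_one i
  omega

/-- The entries of the block upper triangular matrix whose `(s, r)` block, for `s ≤ r`, is the
coefficient of `t ^ (r - s)` in `X`. -/
def blockEntry (X : Matrix (Fin 2) (Fin 2) ℂ⟦X⟧) (i j : ℕ+) : ℂ :=
  if (blockIndex i).1 ≤ (blockIndex j).1 then
    PowerSeries.coeff ((blockIndex j).1 - (blockIndex i).1)
      (X (blockIndex i).2 (blockIndex j).2)
  else 0

/-- The indices whose block is at most the `r`-th one. -/
def blocksUpTo (r : ℕ) : Finset ℕ+ :=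
  ((Finset.range (r + 1)) ×ˢ (Finset.univ : Finset (Fin 2))).map blockIndex.symm.toEmbedding

theorem mem_blocksUpTo {r : ℕ} {i : ℕ+} : i ∈ blocksUpTo r ↔ (blockIndex i).1 ≤ r := by
  simp [blocksUpTo, Finset.mem_map_equiv]

theorem blockEntry_ne_zero {X : Matrix (Fin 2) (Fin 2) ℂ⟦X⟧} {i j : ℕ+}
    (h : blockEntry X i j ≠ 0) : i ∈ blocksUpTo (blockIndex j).1 := by
  rw [mem_blocksUpTo]
  by_contra hij
  exact h (if_neg hij)

theorem blockEntry_finite (X : Matrix (Fin 2) (Fin 2) ℂ⟦X⟧) (j : ℕ+) :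
    (Function.support fun i => blockEntry X i j).Finite :=
  (blocksUpTo (blockIndex j).1).finite_toSet.subset fun _ hi => blockEntry_ne_zero hi

/-- The ring homomorphism identifying `M₂(ℂ[[t]])` with the ring of block upper triangular block
Toeplitz matrices (the inverse of the isomorphism `γ`). -/
def gammaInv : Matrix (Fin 2) (Fin 2) ℂ⟦X⟧ →+* ColFin where
  toFun X := ofMatrix (blockEntry X) (blockEntry_finite X)
  map_one' := ext_entry fun i j => by
    rw [entry_ofMatrix, entry_one, blockEntry]
    by_cases hij : i = j
    · subst hij; simp
    · rw [if_neg hij]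
      split_ifs with h
      · rw [Matrix.one_apply]
        split_ifs with h'
        · rw [PowerSeries.coeff_one, if_neg]
          intro h0
          exact hij (blockIndex.injective (Prod.ext (by omega) h'))
        · simp
      · rfl
  map_mul' X Y := ext_entry fun i j => by
    rw [entry_mul (s := blocksUpTo (blockIndex j).1) _ _ _ _ fun m hm => by
      rw [entry_ofMatrix] at hm; exact blockEntry_ne_zero hm]
    simp only [entry_ofMatrix, blocksUpTo, Finset.sum_map, Equiv.coe_toEmbedding, blockEntry,
      Equiv.apply_symm_apply, Finset.sum_product]
    generalize blockIndex i = p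
    generalize blockIndex j = q
    obtain ⟨s, a⟩ := p
    obtain ⟨r, c⟩ := q
    dsimp only
    split_ifs with h
    · rw [Matrix.mul_apply, map_sum, Finset.sum_comm]
      refine Finset.sum_congr rfl fun e _ => ?_
      rw [PowerSeries.coeff_mul, Finset.Nat.sum_antidiagonal_eq_sum_range_succ
        (fun k l => PowerSeries.coeff k (X a e) * PowerSeries.coeff l (Y e c)),
        show r + 1 = s + (r - s + 1) by omega, Finset.sum_range_add]
      rw [Finset.sum_eq_zero (s := Finset.range s), zero_add]
      · refine Finset.sum_congr rfl fun k hk => ?_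
        have hk' := Finset.mem_range.mp hk
        rw [if_pos (by omega), if_pos (by omega)]
        congr 3 <;> omega
      · intro k hk
        have hk' := Finset.mem_range.mp hk
        rw [if_neg (by omega), zero_mul]
    · refine (Finset.sum_eq_zero fun k hk => Finset.sum_eq_zero fun e _ => ?_).symm
      have hk' := Finset.mem_range.mp hk
      rw [if_neg (by omega), zero_mul]
  map_zero' := ext_entry fun i j => by
    rw [entry_ofMatrix, entry_zero, blockEntry]; simp
  map_add' X Y := ext_entry fun i j => by
    rw [entry_add]
    simp only [entry_ofMatrix, blockEntry]
    split_ifs <;> simp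

/-! ### The representation `τ₁` -/

/-- The numbers `b₀ = b₁ = 1`, `bₙ = - ∑_{i + j = n, i, j ≥ 1} bᵢ bⱼ` for `n ≥ 2`, which are the
Catalan numbers up to sign. -/
def bSeq : ℕ → ℂ
  | 0 => 1
  | n + 1 => (-1) ^ n * catalan n

/-- The power series `g(t)` with `1 + g(t) = ∑ bₖ t ^ k`. -/
def gSeries : ℂ⟦X⟧ := PowerSeries.mk bSeq - 1

theorem gSeries_sq_add : gSeries ^ 2 + gSeries = PowerSeries.X := by
  set c : ℂ⟦X⟧ := PowerSeries.rescale (-1 : ℂ)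
    (PowerSeries.map (Nat.castRingHom ℂ) PowerSeries.catalanSeries) with hc
  have hg : gSeries = PowerSeries.X * c := by
    ext n
    rcases n with _ | n
    · simp [gSeries, bSeq]
    · rw [PowerSeries.coeff_succ_X_mul]
      simp [gSeries, bSeq, hc, PowerSeries.coeff_rescale, PowerSeries.coeff_one]
  have h := congrArg (fun f => PowerSeries.rescale (-1 : ℂ)
    (PowerSeries.map (Nat.castRingHom ℂ) f)) PowerSeries.catalanSeries_sq_mul_X_add_one
  simp only [map_add, map_mul, map_pow, map_one, PowerSeries.map_X, PowerSeries.rescale_X,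
    ← hc, map_neg] at h
  rw [hg]
  linear_combination (-PowerSeries.X : ℂ⟦X⟧) * h

theorem constantCoeff_gSeries : PowerSeries.constantCoeff gSeries = 0 := by
  rw [← PowerSeries.coeff_zero_eq_constantCoeff_apply, gSeries, map_sub, PowerSeries.coeff_mk,
    PowerSeries.coeff_one, if_pos rfl]
  exact sub_self 1

/-- The matrix `γ(S̃)`. -/
def St : SL(2, ℂ⟦X⟧) := ⟨!![0, -1; 1, 0], by simp [Matrix.det_fin_two]⟩

/-- The matrix `γ(J̃)`. -/
def Jt : SL(2, ℂ⟦X⟧) := ⟨!![1, 1 + gSeries; gSeries, 1 + PowerSeries.X], by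
  rw [Matrix.det_fin_two_of, ← gSeries_sq_add]; ring⟩

theorem St_sq : St ^ 2 = -1 := by
  apply Subtype.ext
  have h : ((St ^ 2 : SL(2, ℂ⟦X⟧)) : Matrix (Fin 2) (Fin 2) ℂ⟦X⟧) =
      -(1 : Matrix (Fin 2) (Fin 2) ℂ⟦X⟧) := by
    rw [pow_two, Matrix.SpecialLinearGroup.coe_mul, Matrix.one_fin_two]
    simp only [St, Matrix.mul_fin_two, Matrix.neg_of]
    congr!
    all_goals simp
  exact h

theorem St_Jt_cube : (St * Jt) ^ 3 = -1 := by
  apply Subtype.ext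
  have h : ((St * Jt : SL(2, ℂ⟦X⟧)) : Matrix (Fin 2) (Fin 2) ℂ⟦X⟧) =
      !![-gSeries, -(1 + PowerSeries.X); 1, 1 + gSeries] := by
    rw [Matrix.SpecialLinearGroup.coe_mul]
    simp only [St, Jt, Matrix.mul_fin_two]
    congr! 3 <;> ring_nf
  have h' : (((St * Jt) ^ 3 : SL(2, ℂ⟦X⟧)) : Matrix (Fin 2) (Fin 2) ℂ⟦X⟧) =
      -(1 : Matrix (Fin 2) (Fin 2) ℂ⟦X⟧) := by
    rw [Matrix.SpecialLinearGroup.coe_pow, h, pow_succ, pow_two, Matrix.mul_fin_two,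
      Matrix.mul_fin_two, Matrix.one_fin_two, ← gSeries_sq_add]
    ext i j : 2
    fin_cases i <;> fin_cases j <;>
      simp only [Fin.zero_eta, Fin.mk_one, Matrix.of_apply, Matrix.cons_val', Matrix.cons_val_zero,
        Matrix.cons_val_one, Matrix.cons_val_fin_one, Matrix.neg_apply] <;> ring_nf
  exact h'

theorem St_pow : St ^ 4 = 1 := by
  rw [show 4 = 2 * 2 from rfl, pow_mul, St_sq, neg_one_sq]

theorem St_sq_eq : St ^ 2 = (St * Jt) ^ 3 := by
  rw [St_sq, St_Jt_cube]

/-- The representation `τ₁` of `SL(2, ℤ)`, with `τ₁(S) = S̃` and `τ₁(T) = J̃`. -/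
def tau1 : SL(2, ℤ) →* ColFinˣ :=
  ((Units.map gammaInv.toMonoidHom).comp Matrix.SpecialLinearGroup.toGL).comp
    (liftSL St Jt St_pow St_sq_eq)

/-! ### The representation `τ` -/

/-- The matrix `J̃`. -/
def Jtilde : ColFin := gammaInv Jt.1

/-- The entries of `P`: the `n`-th row of `P` is the first row of `(J̃ - 1) ^ (n - 1)`. -/
def pEntry (n j : ℕ+) : ℂ := entry ((Jtilde - 1) ^ ((n : ℕ) - 1)) 1 j

theorem pEntry_upper : IsUpperUnitriangular pEntry := by
  have hf : StrictMono fun i : ℕ+ => i + 1 := fun i j hij => add_lt_add_left hij 1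
  have hJ : ∀ i j : ℕ+, entry (Jtilde - 1) i j =
      blockEntry (Jt.1) i j - if i = j then 1 else 0 := fun i j => by
    rw [entry_sub, entry_one]
    exact congrArg (· - _) (entry_ofMatrix _ _ i j)
  have hg0 : PowerSeries.coeff 0 gSeries = 0 := by
    rw [PowerSeries.coeff_zero_eq_constantCoeff_apply, constantCoeff_gSeries]
  have hg1 : PowerSeries.coeff 1 gSeries = 1 := by
    simp [gSeries, bSeq, PowerSeries.coeff_one]
  have h0 : ∀ i j : ℕ+, j < i + 1 → entry (Jtilde - 1) i j = 0 := by
    intro i j hij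
    have hij' : (j : ℕ) < i + 1 := hij
    have hi := coe_eq_blockIndex i
    have hj := coe_eq_blockIndex j
    have hinj : blockIndex i = blockIndex j → i = j := fun h => blockIndex.injective h
    rw [hJ, blockEntry]
    generalize blockIndex i = p at *
    generalize blockIndex j = q at *
    obtain ⟨s, a⟩ := p
    obtain ⟨r, c⟩ := q
    dsimp only at *
    have ha := a.isLt
    have hc := c.isLt
    rcases eq_or_ne i j with rfl | hne
    · obtain rfl : s = r := by omega
      obtain rfl : a = c := Fin.ext (by omega)
      fin_cases a <;> simp [Jt]
    · have hne' : (i : ℕ) ≠ j := fun h => hne (PNat.coe_injective h)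
      rw [if_neg hne, sub_zero]
      split_ifs with h
      · obtain rfl : s = r := by omega
        obtain rfl : a = 1 := Fin.ext (show (a : ℕ) = 1 by omega)
        obtain rfl : c = 0 := Fin.ext (show (c : ℕ) = 0 by omega)
        simpa [Jt] using hg0
      · rfl
  have h1 : ∀ i : ℕ+, entry (Jtilde - 1) i (i + 1) = 1 := by
    intro i
    have hne : i ≠ i + 1 := (PNat.lt_add_right i 1).ne
    have hi := coe_eq_blockIndex i
    have hj := coe_eq_blockIndex (i + 1)
    rw [hJ, blockEntry, if_neg hne, sub_zero]
    rw [PNat.add_coe, PNat.one_coe] at hj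
    generalize blockIndex i = p at *
    generalize blockIndex (i + 1) = q at *
    obtain ⟨s, a⟩ := p
    obtain ⟨r, c⟩ := q
    dsimp only at *
    have hc := c.isLt
    rw [if_pos (by omega)]
    fin_cases a
    · obtain rfl : c = 1 := Fin.ext (by simp at *; omega)
      obtain rfl : r = s := by
        simp at hi hj
        omega
      simpa [Jt] using constantCoeff_gSeries
    · obtain rfl : c = 0 := Fin.ext (by simp at *; omega)
      obtain rfl : r = s + 1 := by simp at *; omega
      simpa [Jt] using hg1
  have hit : ∀ n : ℕ+, (fun i : ℕ+ => i + 1)^[(n : ℕ) - 1] 1 = n := by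
    intro n
    induction n using PNat.recOn with
    | one => rfl
    | succ n ih =>
      have : ((n + 1 : ℕ+) : ℕ) - 1 = ((n : ℕ) - 1) + 1 := by
        have := n.pos
        rw [PNat.add_coe, PNat.one_coe]; omega
      rw [this, Function.iterate_succ_apply', ih]
  refine ⟨fun i j hij => ?_, fun i => ?_⟩
  · exact (entry_pow hf h0 h1 ((i : ℕ) - 1) 1).1 j (by rwa [hit])
  · have := (entry_pow hf h0 h1 ((i : ℕ) - 1) 1).2
    rwa [hit] at this

/-- The matrix `P`. -/
def matP : ColFinˣ := unitOfUpper pEntry pEntry_upper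

/-- The representation `τ(Y) = P * τ₁(Y) * P⁻¹` of `SL(2, ℤ)`. -/
def tau : SL(2, ℤ) →* ColFinˣ := (MulAut.conj matP).toMonoidHom.comp tau1

/-! ### The representation `ρ` -/

/-- The entries of `ψ(A)`: the `(i, j)` entry is `A k l` if `i = d * 2 ^ (k - 1)` and
`j = d * 2 ^ (l - 1)` for some odd `d`, and `0` if `i` and `j` have different odd parts. -/
def psiEntry (A : ColFin) (i j : ℕ+) : ℂ :=
  if oddPart i = oddPart j then entry A (v2 i).succPNat (v2 j).succPNat else 0

theorem psiEntry_finite (A : ColFin) (j : ℕ+) :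
    (Function.support fun i => psiEntry A i j).Finite := by
  refine Set.Finite.of_finite_image
    (f := fun i => (v2 i).succPNat) ((A (Finsupp.single (v2 j).succPNat 1)).hasFiniteSupport.subset ?_)
    ?_
  · rintro _ ⟨i, hi, rfl⟩ h0
    refine hi ?_
    simp only [psiEntry]
    split_ifs
    · exact h0
    · rfl
  · intro i hi k hk hik
    have hd : ∀ i, psiEntry A i j ≠ 0 → oddPart i = oddPart j := fun i hi => by
      by_contra h
      exact hi (if_neg h)
    exact eq_of_oddPart_eq ((hd i hi).trans (hd k hk).symm) (Nat.succPNat_injective hik)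

/-- The ring homomorphism `ψ`. -/
def psi : ColFin →+* ColFin where
  toFun A := ofMatrix (psiEntry A) (psiEntry_finite A)
  map_one' := ext_entry fun i j => by
    rw [entry_ofMatrix, psiEntry, entry_one, entry_one]
    by_cases hij : i = j
    · subst hij; simp
    · rw [if_neg hij]
      split_ifs with h h'
      · exact absurd (eq_of_oddPart_eq h (Nat.succPNat_injective h')) hij
      · rfl
      · rfl
  map_mul' A B := ext_entry fun i j => by
    set s := (psiEntry_finite B j).toFinset with hs
    have hmem : ∀ m, psiEntry B m j ≠ 0 → m ∈ s := fun m hm => by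
      rw [hs, Set.Finite.mem_toFinset]; exact hm
    have hmem' : ∀ m ∈ s, oddPart m = oddPart j := fun m hm => by
      rw [hs, Set.Finite.mem_toFinset] at hm
      by_contra h
      exact hm (if_neg h)
    rw [entry_mul (s := s) _ _ _ _ fun m hm => hmem m (by rwa [entry_ofMatrix] at hm)]
    simp only [entry_ofMatrix]
    by_cases hij : oddPart i = oddPart j
    · rw [psiEntry, if_pos hij, entry_mul (s := s.image fun m => (v2 m).succPNat)]
      · rw [Finset.sum_image]
        · refine Finset.sum_congr rfl fun m hm => ?_
          rw [psiEntry, psiEntry, if_pos (hij.trans (hmem' m hm).symm), if_pos (hmem' m hm)]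
        · intro m hm k hk hmk
          exact eq_of_oddPart_eq ((hmem' m hm).trans (hmem' k hk).symm)
            (Nat.succPNat_injective hmk)
      · intro k hk
        obtain ⟨m, hm1, hm2⟩ := exists_oddPart_v2 j k.natPred
        have hk' : (v2 m).succPNat = k := by rw [hm2, PNat.succPNat_natPred]
        refine Finset.mem_image.mpr ⟨m, hmem m ?_, hk'⟩
        rw [psiEntry, if_pos hm1, hk']
        exact hk
    · rw [psiEntry, if_neg hij]
      refine (Finset.sum_eq_zero fun m hm => ?_).symm
      rw [psiEntry, if_neg fun h => hij (h.trans (hmem' m hm)), zero_mul]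
  map_zero' := ext_entry fun i j => by
    rw [entry_ofMatrix, psiEntry]; simp [entry_zero]
  map_add' A B := ext_entry fun i j => by
    rw [entry_add]
    simp only [entry_ofMatrix, psiEntry]
    split_ifs <;> simp [entry_add]

/-- The representation `ρ(Y) = Z⁻¹ * ψ(τ(Y)) * Z` of `SL(2, ℤ)`. -/
def rho : SL(2, ℤ) →* ColFinˣ :=
  ((MulAut.conj matZ⁻¹).toMonoidHom.comp (Units.map psi.toMonoidHom)).comp tau

/-! ### The involution `W(t)` -/

/-- The element `W = !![0, 1; 1, 0]` of `GL(2, ℤ)`. -/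
def elemW : GL (Fin 2) ℤ where
  val := !![0, 1; 1, 0]
  inv := !![0, 1; 1, 0]
  val_inv := by decide
  inv_val := by decide

/-- The power series `1 / √(t ^ 2 + 4 t + 1)`, as the binomial series `(1 + u) ^ (-1 / 2)` at
`u = t ^ 2 + 4 t`. -/
def invSqrt : ℂ⟦X⟧ :=
  (PowerSeries.binomialSeries ℂ (-1 / 2 : ℚ)).subst
    (PowerSeries.X ^ 2 + 4 * PowerSeries.X : ℂ⟦X⟧)

theorem invSqrt_spec :
    invSqrt ^ 2 * (PowerSeries.X ^ 2 + 4 * PowerSeries.X + 1) = 1 ∧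
      PowerSeries.constantCoeff invSqrt = 1 := by
  have h0 : PowerSeries.constantCoeff (PowerSeries.X ^ 2 + 4 * PowerSeries.X : ℂ⟦X⟧) = 0 := by
    simp
  have hs : PowerSeries.HasSubst (PowerSeries.X ^ 2 + 4 * PowerSeries.X : ℂ⟦X⟧) :=
    PowerSeries.HasSubst.of_constantCoeff_zero' h0
  have h1 : (PowerSeries.binomialSeries ℂ (-1 / 2 : ℚ)) ^ 2 * (1 + PowerSeries.X) = 1 := by
    have hn := PowerSeries.binomialSeries_nat (R := ℚ) (A := ℂ) 1
    rw [pow_one] at hn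
    rw [pow_two, ← PowerSeries.binomialSeries_add, ← hn, ← PowerSeries.binomialSeries_add]
    norm_num
  constructor
  · have := congrArg (PowerSeries.subst (PowerSeries.X ^ 2 + 4 * PowerSeries.X : ℂ⟦X⟧)) h1
    rw [PowerSeries.subst_mul hs, PowerSeries.subst_pow hs, PowerSeries.subst_add hs,
      PowerSeries.subst_X hs] at this
    have hone : PowerSeries.subst (PowerSeries.X ^ 2 + 4 * PowerSeries.X : ℂ⟦X⟧) (1 : ℂ⟦X⟧) = 1 := by
      rw [← PowerSeries.coe_substAlgHom hs, map_one]
    rw [hone, add_comm 1] at this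
    exact this
  · set f := PowerSeries.binomialSeries ℂ (-1 / 2 : ℚ) with hf
    have hf0 : PowerSeries.constantCoeff (f - 1) = 0 := by
      rw [map_sub, hf, PowerSeries.binomialSeries_constantCoeff, map_one, sub_self]
    have h2 := PowerSeries.constantCoeff_subst_eq_zero h0 (f - 1) hf0
    have h3 : PowerSeries.subst (PowerSeries.X ^ 2 + 4 * PowerSeries.X : ℂ⟦X⟧) (f - 1) =
        invSqrt - 1 := by
      rw [← PowerSeries.coe_substAlgHom hs, map_sub, map_one, PowerSeries.coe_substAlgHom hs]
      rfl
    rw [h3] at h2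
    have h4 : PowerSeries.constantCoeff (invSqrt - 1) = 0 := h2
    rwa [map_sub, map_one, sub_eq_zero] at h4

/-- The matrix `W(t)`. -/
def Wt : Matrix (Fin 2) (Fin 2) ℂ⟦X⟧ :=
  invSqrt • !![-PowerSeries.X, 2 * gSeries + 1; 2 * gSeries + 1, PowerSeries.X]

end

end DivisorMatrix

open DivisorMatrix

/-! Since `(2g+1)^2 = 4t+1`, the unnormalised matrix in `Wt` squares to `t^2+4t+1`, so `Wt` is an
involution. It moves past `St` and `Jt` as `W` moves past `S` and `T` (`St_mul_Wt`, `Jt_mul_Wt`),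
and `GL(2,Z)` is the disjoint union of `SL(2,Z)` and `SL(2,Z) W`; hence `τ₁`, and with it `τ` and
`ρ`, extends (`exists_extension`).

The growth of `ρ` rests on one observation: `ψ` puts column `l` of a matrix into the columns `d
2^(l-1)`, so bounds exponential in `l` become polynomial in the column number (`psi_mem_DR0`). It
remains to show that `γ⁻¹(Wt)`, `P` and `P⁻¹` lie in `expGrowth` and that `Z` and `Z⁻¹` lie in
`DR0`. Power series with exponentially bounded coefficients are closed under ring operations,
reciprocals and square roots, which covers `g` and `Wt`. The rows of `P` are rows of powers of a
strictly upper triangular matrix. Conjugation by `P` turns `γ⁻¹(Jt')` into the shift, hence turns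
scalar matrices into Toeplitz matrices, and this gives the rows of `P⁻¹` explicitly
(`exists_inv_matP_row`). For `Z`, think of Dirichlet series: with `x = 2^(-s)` and `1 + o` the odd
part of zeta, `Z⁻¹ x Z = D - 1 = (x+o)/(1-x)`, while `Z` commutes with `o`. Solving for `x` gives `Z
x Z⁻¹ = (x-o)/(1+x)`, so `Z⁻¹` is built from `signedDivisors` as `Z` is from `D - 1`; powers of
either matrix have entries at most `j^2` in column `j`.

Integrality fails because the coefficient of `t^3` in `Wt 0 0` is `-11/2`. The image of `SL(2,Z)`
under `τ₁` is integral, and `P` and `Z` are integral with integral inverses, so every element of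
determinant `-1` inherits the failure. -/

namespace DivisorMatrix

/-! ### Power series with exponentially bounded coefficients -/

/-- After division by `M^n` this is `1 + 2 + ... + 2^(n-1) ≤ 2^n`. It makes `(2M)^n` a weight that
survives convolution with `M^n`. -/
theorem sum_pow_mul_two_pow_le {M : ℝ} (hM : 0 ≤ M) (n : ℕ) :
    ∑ m ∈ Finset.range n, (2 * M) ^ m * M ^ (n - m) ≤ (2 * M) ^ n := by
  induction n with
  | zero => simp
  | succ n ih =>
    rw [Finset.sum_range_succ, Nat.add_sub_cancel_left]
    have : ∑ m ∈ Finset.range n, (2 * M) ^ m * M ^ (n + 1 - m) =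
        (∑ m ∈ Finset.range n, (2 * M) ^ m * M ^ (n - m)) * M := by
      rw [Finset.sum_mul]
      refine Finset.sum_congr rfl fun m hm => ?_
      rw [Nat.succ_sub (Finset.mem_range.mp hm).le, pow_succ, mul_assoc]
    rw [this]
    calc _ ≤ (2 * M) ^ n * M + (2 * M) ^ n * M ^ 1 := by gcongr
      _ = _ := by ring

theorem succ_le_two_pow (n : ℕ) : (n : ℝ) + 1 ≤ 2 ^ n := by
  exact_mod_cast Nat.lt_two_pow_self

/-- The subring of power series whose coefficients grow at most exponentially. -/
def expBounded : Subring ℂ⟦X⟧ where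
  -- The exponent `n + 1` leaves the constant term free; with exponent `n` it would be at most `1`
  -- in norm, and sums would leave the set.
  carrier := {a | ∃ K : ℝ, 1 ≤ K ∧ ∀ n, ‖PowerSeries.coeff n a‖ ≤ K ^ (n + 1)}
  mul_mem' := by
    rintro a b ⟨K, hK, ha⟩ ⟨L, hL, hb⟩
    refine ⟨2 * K * L, by nlinarith, fun n => ?_⟩
    rw [PowerSeries.coeff_mul]
    have hterm : ∀ p ∈ Finset.HasAntidiagonal.antidiagonal n,
        ‖PowerSeries.coeff p.1 a * PowerSeries.coeff p.2 b‖ ≤ K ^ (n + 1) * L ^ (n + 1) := by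
      intro p hp
      have := Finset.HasAntidiagonal.mem_antidiagonal.mp hp
      rw [norm_mul]
      have h1 : K ^ (p.1 + 1) ≤ K ^ (n + 1) := pow_le_pow_right₀ hK (by omega)
      have h2 : L ^ (p.2 + 1) ≤ L ^ (n + 1) := pow_le_pow_right₀ hL (by omega)
      exact mul_le_mul ((ha _).trans h1) ((hb _).trans h2) (norm_nonneg _) (by positivity)
    refine (norm_sum_le_of_le _ hterm).trans ?_
    -- The number `n + 1` of terms in the convolution is absorbed by `2 ^ (n + 1)`.
    rw [Finset.sum_const, Finset.Nat.card_antidiagonal, nsmul_eq_mul, mul_pow, mul_pow]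
    push_cast
    have := succ_le_two_pow n
    have : (n : ℝ) + 1 ≤ 2 ^ (n + 1) := by rw [pow_succ]; linarith [pow_pos (two_pos : (0:ℝ) < 2) n]
    rw [mul_assoc (2 ^ (n + 1) : ℝ)]
    gcongr
  one_mem' := ⟨1, le_rfl, fun n => by
    rw [PowerSeries.coeff_one]; split_ifs <;> simp⟩
  add_mem' := by
    rintro a b ⟨K, hK, ha⟩ ⟨L, hL, hb⟩
    refine ⟨K + L, by linarith, fun n => ?_⟩
    rw [map_add]
    refine (norm_add_le_of_le (ha n) (hb n)).trans ?_
    exact pow_add_pow_le (by linarith) (by linarith) (Nat.succ_ne_zero n)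
  zero_mem' := ⟨1, le_rfl, fun n => by simp⟩
  neg_mem' := by
    rintro a ⟨K, hK, ha⟩
    exact ⟨K, hK, fun n => by rw [map_neg, norm_neg]; exact ha n⟩

/-- For `n ≥ 1` one has `n + 1 ≤ 2n`, so `K^2` serves. Constant terms are controlled separately
wherever this is used. -/
theorem exists_pow_bound {a : ℂ⟦X⟧} (ha : a ∈ expBounded) :
    ∃ M : ℝ, 1 ≤ M ∧ ∀ n, n ≠ 0 → ‖PowerSeries.coeff n a‖ ≤ M ^ n := by
  obtain ⟨K, hK, ha⟩ := ha
  refine ⟨K ^ 2, one_le_pow₀ hK, fun n hn => (ha n).trans ?_⟩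
  rw [← pow_mul]
  exact pow_le_pow_right₀ hK (by omega)

theorem mem_expBounded_of_pow_bound {a : ℂ⟦X⟧} {M : ℝ} (hM : 1 ≤ M)
    (h : ∀ n, ‖PowerSeries.coeff n a‖ ≤ M ^ n) : a ∈ expBounded :=
  ⟨M, hM, fun n => (h n).trans (pow_le_pow_right₀ hM n.le_succ)⟩

theorem X_mem_expBounded : (PowerSeries.X : ℂ⟦X⟧) ∈ expBounded :=
  mem_expBounded_of_pow_bound le_rfl fun n => by
    rw [PowerSeries.coeff_X]; split_ifs <;> simp

theorem C_mem_expBounded (c : ℂ) : PowerSeries.C c ∈ expBounded := by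
  refine ⟨max 1 ‖c‖, le_max_left _ _, fun n => ?_⟩
  rw [PowerSeries.coeff_C]
  split_ifs with h
  · subst h; simp
  · rw [norm_zero]; positivity

theorem exists_common_bound {X : Matrix (Fin 2) (Fin 2) ℂ⟦X⟧} (hX : ∀ a b, X a b ∈ expBounded) :
    ∃ K : ℝ, 1 ≤ K ∧ ∀ a b n, ‖PowerSeries.coeff n (X a b)‖ ≤ K ^ (n + 1) := by
  choose M hM hb using hX
  have h0 : ∀ i j, 0 ≤ M i j := fun i j => zero_le_one.trans (hM i j)
  have hle : ∀ i j, M i j ≤ ∑ a, ∑ b, M a b := fun i j =>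
    (Finset.single_le_sum (f := fun j => M i j) (fun j _ => h0 i j) (Finset.mem_univ j)).trans
      (Finset.single_le_sum (f := fun i => ∑ j, M i j)
        (fun i _ => Finset.sum_nonneg fun j _ => h0 i j) (Finset.mem_univ i))
  exact ⟨∑ a, ∑ b, M a b, (hM 0 0).trans (hle 0 0),
    fun a b n => (hb a b n).trans (pow_le_pow_left₀ (h0 a b) (hle a b) _)⟩

/-- The reciprocal of an exponentially bounded series is exponentially bounded. -/
theorem expBounded_of_mul_eq_one {a b : ℂ⟦X⟧} (ha : a ∈ expBounded)
    (h0 : PowerSeries.constantCoeff a = 1) (hab : a * b = 1) : b ∈ expBounded := by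
  obtain ⟨M, hM, ha⟩ := exists_pow_bound ha
  refine mem_expBounded_of_pow_bound (M := 2 * M) (by linarith) fun n => ?_
  induction n using Nat.strong_induction_on with
  | _ n ih =>
    have h := congrArg (PowerSeries.coeff n) hab
    rw [mul_comm, PowerSeries.coeff_mul, Finset.Nat.sum_antidiagonal_eq_sum_range_succ
      (fun k l => PowerSeries.coeff k b * PowerSeries.coeff l a), Finset.sum_range_succ,
      Nat.sub_self, PowerSeries.coeff_zero_eq_constantCoeff_apply, h0, mul_one,
      PowerSeries.coeff_one] at h
    rcases Nat.eq_zero_or_pos n with rfl | hn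
    · simp at h; simp [h]
    · rw [if_neg hn.ne', add_comm] at h
      rw [eq_neg_of_add_eq_zero_left h, norm_neg]
      refine (norm_sum_le_of_le _ fun m hm => ?_).trans (sum_pow_mul_two_pow_le (by linarith) n)
      have hm := Finset.mem_range.mp hm
      rw [norm_mul]
      exact mul_le_mul (ih m hm) (ha _ (by omega)) (norm_nonneg _) (by positivity)

theorem catalan_le_four_pow (n : ℕ) : catalan n ≤ 4 ^ n := by
  rw [catalan_eq_centralBinom_div]
  refine (Nat.div_le_self _ _).trans ?_
  rw [Nat.centralBinom, show 4 = 2 ^ 2 from rfl, ← pow_mul]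
  exact Nat.choose_le_two_pow _ _

theorem one_le_catalan (n : ℕ) : 1 ≤ catalan n := by
  rw [Nat.one_le_iff_ne_zero]
  intro h
  have := succ_mul_catalan_eq_centralBinom n
  rw [h, mul_zero] at this
  exact (Nat.centralBinom_pos n).ne this

/-- The square root of an exponentially bounded series is exponentially bounded. -/
theorem expBounded_of_sq {b : ℂ⟦X⟧} (hb : b ^ 2 ∈ expBounded)
    (h0 : PowerSeries.constantCoeff b = 1) : b ∈ expBounded := by
  obtain ⟨M, hM, hq⟩ := exists_pow_bound hb
  -- The coefficients of a square root satisfy a quadratic convolution recursion like that of the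
  -- Catalan numbers, which therefore majorise them.
  have key : ∀ n, ‖PowerSeries.coeff (n + 1) b‖ ≤ M ^ (n + 1) * catalan n := by
    intro n
    induction n using Nat.strong_induction_on with
    | _ n ih =>
      have h : PowerSeries.coeff (n + 1) (b ^ 2) = 2 * PowerSeries.coeff (n + 1) b +
          ∑ m ∈ Finset.range n, PowerSeries.coeff (m + 1) b * PowerSeries.coeff (n - m) b := by
        rw [pow_two, PowerSeries.coeff_mul, Finset.Nat.sum_antidiagonal_eq_sum_range_succ
          (fun k l => PowerSeries.coeff k b * PowerSeries.coeff l b), Finset.sum_range_succ,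
          Finset.sum_range_succ', Nat.sub_self, Nat.sub_zero,
          PowerSeries.coeff_zero_eq_constantCoeff_apply, h0,
          Finset.sum_congr rfl fun m _ => by rw [Nat.add_sub_add_right]]
        ring
      have hsum : ‖∑ m ∈ Finset.range n, PowerSeries.coeff (m + 1) b *
          PowerSeries.coeff (n - m) b‖ ≤ M ^ (n + 1) * catalan n := by
        rcases n with _ | n
        · simp; positivity
        rw [catalan_succ', Nat.cast_sum, Finset.mul_sum,
          Finset.Nat.sum_antidiagonal_eq_sum_range_succ
            (fun k l => M ^ (n + 1 + 1) * ((catalan k * catalan l : ℕ) : ℝ))]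
        refine norm_sum_le_of_le _ fun m hm => ?_
        have hm := Finset.mem_range.mp hm
        have h1 := ih m hm
        have h2 := ih (n - m) (by omega)
        rw [show n - m + 1 = n + 1 - m by omega] at h2
        rw [norm_mul]
        refine (mul_le_mul h1 h2 (norm_nonneg _) (by positivity)).trans (le_of_eq ?_)
        rw [show n + 1 + 1 = (m + 1) + (n + 1 - m) by omega, pow_add]
        push_cast
        ring
      have h2 : 2 * ‖PowerSeries.coeff (n + 1) b‖ ≤
          M ^ (n + 1) + M ^ (n + 1) * catalan n := by
        have : (2 : ℂ) * PowerSeries.coeff (n + 1) b = PowerSeries.coeff (n + 1) (b ^ 2) -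
          ∑ m ∈ Finset.range n, PowerSeries.coeff (m + 1) b * PowerSeries.coeff (n - m) b := by
          rw [h]; ring
        rw [← Complex.norm_two, ← norm_mul, this]
        exact norm_sub_le_of_le (hq _ n.succ_ne_zero) hsum
      -- Since `catalan n ≥ 1`, the contribution of `b ^ 2` is also at most `M ^ (n + 1) * catalan
      -- n`; the factor `2` on the left pays for both terms.
      have h3 : (1 : ℝ) ≤ catalan n := by exact_mod_cast one_le_catalan n
      have h4 : M ^ (n + 1) * 1 ≤ M ^ (n + 1) * catalan n := by gcongr
      linarith
  refine mem_expBounded_of_pow_bound (M := 4 * M) (by linarith) fun n => ?_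
  rcases n with _ | n
  · simp [h0]
  · refine (key n).trans ?_
    have : (catalan n : ℝ) ≤ 4 ^ n := by exact_mod_cast catalan_le_four_pow n
    have h4 : (4 : ℝ) ^ n ≤ 4 ^ (n + 1) := pow_le_pow_right₀ (by norm_num) n.le_succ
    rw [mul_pow, mul_comm]
    gcongr
    exact this.trans h4

theorem gSeries_mem_expBounded : gSeries ∈ expBounded := by
  refine expBounded.sub_mem (mem_expBounded_of_pow_bound (M := 4) (by norm_num) fun n => ?_)
    expBounded.one_mem
  rw [PowerSeries.coeff_mk]
  rcases n with _ | n
  · simp [bSeq]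
  · rw [bSeq, norm_mul, norm_pow, norm_neg, norm_one, one_pow, one_mul, Complex.norm_natCast]
    have h4 : (4 : ℝ) ^ n ≤ 4 ^ (n + 1) := pow_le_pow_right₀ (by norm_num) n.le_succ
    exact le_trans (by exact_mod_cast catalan_le_four_pow n) h4

theorem invSqrt_mem_expBounded : invSqrt ∈ expBounded := by
  obtain ⟨h1, h2⟩ := invSqrt_spec
  refine expBounded_of_sq (expBounded_of_mul_eq_one
    (a := PowerSeries.X ^ 2 + 4 * PowerSeries.X + 1) ?_ (by simp) (by rw [mul_comm, h1])) h2
  have hX := X_mem_expBounded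
  exact add_mem (add_mem (pow_mem hX 2) (mul_mem (natCast_mem expBounded 4) hX)) (one_mem _)

theorem Wt_mem_expBounded (i j : Fin 2) : Wt i j ∈ expBounded := by
  have hg : 2 * gSeries + 1 ∈ expBounded :=
    add_mem (mul_mem (natCast_mem expBounded 2) gSeries_mem_expBounded) (one_mem _)
  have hX := X_mem_expBounded
  rw [Wt, Matrix.smul_apply, smul_eq_mul]
  refine mul_mem invSqrt_mem_expBounded ?_
  fin_cases i <;> fin_cases j <;> simp [hg, hX]

/-! ### The matrix `W(t)` -/

/-- From `g^2 + g = t` follows `(2g+1)^2 = 4t+1`, so both diagonal entries of the unnormalised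
square are `t^2+4t+1`. -/
theorem Wt_mul_self : Wt * Wt = 1 := by
  have h := invSqrt_spec.1
  have hg := gSeries_sq_add
  rw [Wt, Matrix.smul_mul, Matrix.mul_smul, smul_smul, Matrix.mul_fin_two, Matrix.one_fin_two]
  ext i j : 1
  fin_cases i <;> fin_cases j <;>
    simp only [Matrix.smul_apply, smul_eq_mul, Fin.zero_eta, Fin.mk_one, Matrix.of_apply,
      Matrix.cons_val', Matrix.cons_val_zero, Matrix.cons_val_one, Matrix.cons_val_fin_one]
  · linear_combination h + 4 * invSqrt ^ 2 * hg
  · ring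
  · ring
  · linear_combination h + 4 * invSqrt ^ 2 * hg

theorem Wt_constantCoeff : Wt.map PowerSeries.constantCoeff = !![0, 1; 1, 0] := by
  have h := invSqrt_spec.2
  have hg := constantCoeff_gSeries
  ext i j
  fin_cases i <;> fin_cases j <;> simp [Wt, h, hg]

theorem Wt_growth : ∃ C : ℝ, ∀ (i j : Fin 2) (n : ℕ),
    ‖PowerSeries.coeff n (Wt i j)‖ ≤ (2 : ℝ) ^ (C * (n : ℝ)) := by
  obtain ⟨K, hK, hb⟩ := exists_common_bound Wt_mem_expBounded
  -- With `2^C = K^2` the bound `K^(n+1) ≤ K^(2n)` settles `n ≥ 1`. At `n = 0` the bound is `1`, and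
  -- the entries of `W(0)` are `0` and `1`.
  refine ⟨Real.logb 2 (K ^ 2), fun i j n => ?_⟩
  rw [Real.rpow_mul two_pos.le, Real.rpow_logb two_pos (by norm_num) (by positivity),
    Real.rpow_natCast]
  rcases eq_or_ne n 0 with rfl | hn
  · have h := congrFun (congrFun Wt_constantCoeff i) j
    rw [Matrix.map_apply] at h
    rw [PowerSeries.coeff_zero_eq_constantCoeff_apply, h]
    fin_cases i <;> fin_cases j <;> simp
  · refine (hb i j n).trans ?_
    rw [← pow_mul]
    exact pow_le_pow_right₀ hK (by omega)

/-- The image of the relation `W S W = S^3` (`conjW_S`); here `St ^ 3 = -St`. -/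
theorem St_mul_Wt :
    (St : Matrix (Fin 2) (Fin 2) ℂ⟦X⟧) * Wt = Wt * ((St ^ 3 : SL(2, ℂ⟦X⟧)) : Matrix _ _ _) := by
  rw [pow_succ, St_sq, neg_one_mul, Matrix.SpecialLinearGroup.coe_neg]
  ext i j : 1
  fin_cases i <;> fin_cases j <;> simp [Wt, St, Matrix.mul_apply, Fin.sum_univ_two]

/-- The image of the relation `W T W = T S T` (`conjW_T`). The product `Jt * St * Jt` is the
transpose of `Jt`, and `Wt` is symmetric, so the claim is that `Jt * Wt` is symmetric. -/
theorem Jt_mul_Wt : (Jt : Matrix (Fin 2) (Fin 2) ℂ⟦X⟧) * Wt =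
    Wt * ((Jt * St * Jt : SL(2, ℂ⟦X⟧)) : Matrix _ _ _) := by
  have hg := gSeries_sq_add
  have h : ((Jt * St * Jt : SL(2, ℂ⟦X⟧)) : Matrix (Fin 2) (Fin 2) ℂ⟦X⟧) =
      !![1, gSeries; 1 + gSeries, 1 + PowerSeries.X] := by
    rw [Matrix.SpecialLinearGroup.coe_mul, Matrix.SpecialLinearGroup.coe_mul]
    simp only [Jt, St, Matrix.mul_fin_two]
    ext i j : 1
    fin_cases i <;> fin_cases j <;>
      simp only [Matrix.of_apply, Fin.zero_eta, Fin.mk_one,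
        Matrix.cons_val', Matrix.cons_val_zero, Matrix.cons_val_one, Matrix.cons_val_fin_one]
    · ring
    · linear_combination hg
    · linear_combination -hg
    · ring
  rw [h, Wt, Matrix.mul_smul, Matrix.smul_mul]
  congr 1
  simp only [Jt, Matrix.mul_fin_two]
  ext i j : 1
  fin_cases i <;> fin_cases j <;>
    simp only [Matrix.of_apply, Fin.zero_eta, Fin.mk_one,
      Matrix.cons_val', Matrix.cons_val_zero, Matrix.cons_val_one, Matrix.cons_val_fin_one]
  all_goals ring

/-- `(t^2+4t+1)^(-1/2)` begins `1 - 2t + (11/2)t^2`; the coefficients are read off from `invSqrt ^ 2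
* (t^2+4t+1) = 1` in degrees `1` and `2`. -/
theorem coeff_Wt : PowerSeries.coeff 3 (Wt 0 0) = -(11 / 2) := by
  obtain ⟨h1, h0⟩ := invSqrt_spec
  have hW : Wt 0 0 = -(invSqrt * PowerSeries.X) := by simp [Wt]
  rw [hW, map_neg, PowerSeries.coeff_succ_mul_X]
  have e : invSqrt ^ 2 * (PowerSeries.X ^ 2 + 4 * PowerSeries.X + 1) =
    invSqrt ^ 2 * PowerSeries.X ^ 2 + PowerSeries.C 4 * (invSqrt ^ 2 * PowerSeries.X) +
      invSqrt ^ 2 := by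
    rw [show PowerSeries.C (4 : ℂ) = 4 from map_ofNat _ 4]; ring
  rw [e] at h1
  have c0 : PowerSeries.coeff 0 invSqrt = 1 := by
    rw [PowerSeries.coeff_zero_eq_constantCoeff_apply, h0]
  have s0 : PowerSeries.coeff 0 (invSqrt ^ 2) = 1 := by
    rw [PowerSeries.coeff_zero_eq_constantCoeff_apply, map_pow, h0, one_pow]
  have s1 : PowerSeries.coeff 1 (invSqrt ^ 2) = 2 * PowerSeries.coeff 1 invSqrt := by
    rw [pow_two, PowerSeries.coeff_mul, Finset.Nat.sum_antidiagonal_eq_sum_range_succ_mk]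
    simp [Finset.sum_range_succ, h0]; ring
  have s2 : PowerSeries.coeff 2 (invSqrt ^ 2) = 2 * PowerSeries.coeff 2 invSqrt +
      PowerSeries.coeff 1 invSqrt ^ 2 := by
    rw [pow_two, PowerSeries.coeff_mul, Finset.Nat.sum_antidiagonal_eq_sum_range_succ_mk]
    simp [Finset.sum_range_succ, h0]; ring
  have e1 := congrArg (PowerSeries.coeff 1) h1
  have e2 := congrArg (PowerSeries.coeff 2) h1
  simp only [map_add, PowerSeries.coeff_C_mul, PowerSeries.coeff_mul_X_pow',
    PowerSeries.coeff_succ_mul_X, PowerSeries.coeff_one] at e1 e2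
  rw [s0, s1] at e1
  rw [s1, s2] at e2
  norm_num [h0] at e1 e2
  have c1 : PowerSeries.coeff 1 invSqrt = -2 := by linear_combination e1 / 2
  rw [c1] at e2
  linear_combination -e2 / 2

/-! ### Rows of products -/

theorem entry_mul_support (A B : ColFin) (i j : ℕ+) :
    entry (A * B) i j =
      ∑ m ∈ (B (Finsupp.single j 1)).support, entry A i m * entry B m j :=
  entry_mul A B i j fun _ hm => Finsupp.mem_support_iff.mpr hm

/-- A row of a product depends only on that row of the left factor. This allows matrix identities to
be proved row by row, without tracking column supports. -/
theorem entry_mul_row_congr {A A' : ColFin} {i i' : ℕ+} (h : entry A i = entry A' i')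
    (B : ColFin) : entry (A * B) i = entry (A' * B) i' := by
  funext j
  simp only [entry_mul_support, h]

theorem entry_mul_of_row_single {A : ColFin} {i k : ℕ+} (h : entry A i = entry 1 k)
    (B : ColFin) : entry (A * B) i = entry B k := by
  rw [entry_mul_row_congr h, one_mul]

theorem ext_row {A B : ColFin} (h : ∀ i, entry A i = entry B i) : A = B :=
  ext_entry fun i j => congrFun (h i) j

/-! ### Upper unitriangular matrices -/

theorem isUnit_of_upper {A : ColFin} (h : IsUpperUnitriangular (entry A)) : IsUnit A := by
  have : ofMatrix (entry A) h.finite = A := ext_entry fun i j => entry_ofMatrix _ _ i j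
  exact this ▸ h.isUnit

theorem entry_unitOfUpper (a : ℕ+ → ℕ+ → ℂ) (h : IsUpperUnitriangular a) (i j : ℕ+) :
    entry (unitOfUpper a h : ColFin) i j = a i j := by
  have : (unitOfUpper a h : ColFin) = ofMatrix a h.finite := h.isUnit.unit_spec
  rw [this, entry_ofMatrix]

/-- Solving an upper unitriangular system by back substitution, keeping track of subgroups that
contain the entries of the solution. -/
theorem mem_of_upper_apply {A : ColFin} (hA : IsUpperUnitriangular (entry A))
    (V : ℕ+ → AddSubgroup ℂ) (hV : ∀ i k, i < k → ∀ z ∈ V k, entry A i k * z ∈ V i)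
    {v : ℕ+ →₀ ℂ} (hv : ∀ i, A v i ∈ V i) (i : ℕ+) : v i ∈ V i := by
  classical
  by_contra hi
  have hs : (v.support.filter fun m => v m ∉ V m).Nonempty := by
    refine ⟨i, Finset.mem_filter.mpr ⟨Finsupp.mem_support_iff.mpr fun h => hi ?_, hi⟩⟩
    rw [h]; exact zero_mem _
  -- At the largest index `m` where the claim fails, row `m` of the system expresses `v m` through
  -- later coordinates, for which the claim holds.
  set m := Finset.max' _ hs with hm
  obtain ⟨hm1, hm2⟩ := Finset.mem_filter.mp (Finset.max'_mem _ hs)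
  have h := hv m
  rw [apply_eq_sum A v m subset_rfl, ← Finset.add_sum_erase _ _ hm1, hA.2, one_mul] at h
  refine hm2 ((AddSubgroup.add_mem_cancel_right _ (sum_mem fun k hk => ?_)).mp h)
  obtain ⟨hk1, hk2⟩ := Finset.mem_erase.mp hk
  rcases lt_or_gt_of_ne hk1 with hlt | hgt
  · rw [hA.1 _ _ hlt, zero_mul]; exact zero_mem _
  · refine hV _ _ hgt _ ?_
    by_contra hk3
    exact absurd (Finset.le_max' _ k (Finset.mem_filter.mpr ⟨hk2, hk3⟩)) (not_le.mpr hgt)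

theorem apply_inv_single (u : ColFinˣ) (j : ℕ+) :
    (u : ColFin) (((u⁻¹ : ColFinˣ) : ColFin) (Finsupp.single j 1) : ℕ+ →₀ ℂ) = Finsupp.single j 1 := by
  have h := u.mul_inv
  exact LinearMap.congr_fun h (Finsupp.single j 1)

theorem entry_inv_of_lt {u : ColFinˣ} (hu : IsUpperUnitriangular (entry (u : ColFin))) {i j : ℕ+}
    (hij : j < i) : entry (u⁻¹ : ColFinˣ) i j = 0 := by
  -- The coordinates beyond `j` are forced to be zero, the others are unrestricted.
  have key := mem_of_upper_apply hu (fun k => if j < k then ⊥ else ⊤) ?_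
    (v := ((u⁻¹ : ColFinˣ) : ColFin) (Finsupp.single j 1)) ?_ i
  · rw [if_pos hij] at key
    exact AddSubgroup.mem_bot.mp key
  · intro i k hik z hz
    by_cases h : j < i
    · rw [if_pos (h.trans hik)] at hz
      rw [AddSubgroup.mem_bot.mp hz, mul_zero]
      exact zero_mem _
    · rw [if_neg h]; trivial
  · intro k
    rw [apply_inv_single]
    split_ifs with h
    · rw [AddSubgroup.mem_bot]
      exact Finsupp.single_eq_of_ne h.ne'
    · trivial

theorem entry_inv_row {u : ColFinˣ} {i k : ℕ+} (h : entry (u : ColFin) i = entry 1 k) :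
    entry (u⁻¹ : ColFinˣ) k = entry 1 i := by
  rw [← entry_mul_of_row_single h _, u.mul_inv]

/-! ### Integer matrices -/

/-- The ring of column-finite integer matrices. -/
def integerMatrices : Subring ColFin where
  carrier := {A | IsIntegerMatrix A}
  mul_mem' := by
    intro A B hA hB i j
    choose a ha using hA
    choose b hb using hB
    refine ⟨∑ m ∈ (B (Finsupp.single j 1)).support, a i m * b m j, ?_⟩
    rw [entry_mul_support]
    push_cast
    simp only [ha, hb]
  one_mem' := fun i j => ⟨if i = j then 1 else 0, by rw [entry_one]; split_ifs <;> simp⟩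
  add_mem' := by
    intro A B hA hB i j
    obtain ⟨a, ha⟩ := hA i j
    obtain ⟨b, hb⟩ := hB i j
    exact ⟨a + b, by rw [entry_add, ha, hb]; push_cast; rfl⟩
  zero_mem' := fun i j => ⟨0, by simp [entry_zero]⟩
  neg_mem' := by
    intro A hA i j
    obtain ⟨a, ha⟩ := hA i j
    exact ⟨-a, by rw [entry_neg, ha]; push_cast; rfl⟩

theorem inv_mem_integerMatrices {u : ColFinˣ} (hu : IsUpperUnitriangular (entry (u : ColFin)))
    (h : (u : ColFin) ∈ integerMatrices) : ((u⁻¹ : ColFinˣ) : ColFin) ∈ integerMatrices := by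
  intro i j
  have key := mem_of_upper_apply hu (fun _ => (Int.castAddHom ℂ).range) ?_
    (v := ((u⁻¹ : ColFinˣ) : ColFin) (Finsupp.single j 1)) ?_ i
  · obtain ⟨n, hn⟩ := key
    exact ⟨n, hn.symm⟩
  · rintro i k - _ ⟨z, rfl⟩
    obtain ⟨a, ha⟩ := h i k
    exact ⟨a * z, by rw [ha]; simp⟩
  · intro k
    rw [apply_inv_single, Finsupp.single_apply]
    split_ifs
    · exact ⟨1, by simp⟩
    · exact zero_mem _

/-! ### Powers of matrices with controlled entries -/

/-- If `φ ≥ 1` is a row vector with `φ |N| ≤ φ`, then the entries in each column of every power of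
`N` are bounded by the corresponding entry of `φ`. -/
theorem norm_entry_pow_le {N : ColFin} {φ : ℕ+ → ℝ} (h1 : ∀ j, 1 ≤ φ j) (s : ℕ+ → Finset ℕ+)
    (hs : ∀ m j, entry N m j ≠ 0 → m ∈ s j)
    (h : ∀ j, ∑ m ∈ s j, φ m * ‖entry N m j‖ ≤ φ j) (k : ℕ) (i j : ℕ+) :
    ‖entry (N ^ k) i j‖ ≤ φ j := by
  induction k generalizing j with
  | zero =>
    rw [pow_zero, entry_one]
    split_ifs
    · rw [norm_one]; exact h1 j
    · rw [norm_zero]; exact zero_le_one.trans (h1 j)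
  | succ k ih =>
    rw [pow_succ, entry_mul _ _ _ _ fun m => hs m j]
    refine (norm_sum_le_of_le _ fun m _ => ?_).trans (h j)
    rw [norm_mul]
    exact mul_le_mul_of_nonneg_right (ih m) (norm_nonneg _)

/-- `Finset.range j` contains `0`, which is not a positive integer; hence the term `f 0`. -/
theorem sum_Iio_pnat (j : ℕ+) (f : ℕ → ℝ) :
    ∑ m ∈ Finset.Iio j, f m ≤ ∑ m ∈ Finset.range j, f m - f 0 := by
  refine le_of_eq ?_
  obtain ⟨n, hn⟩ : ∃ n, (j : ℕ) = n + 1 := ⟨_, (PNat.natPred_add_one j).symm⟩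
  rw [hn, Finset.sum_range_succ', add_sub_cancel_right]
  symm
  refine Finset.sum_bij' (fun m _ => m.succPNat) (fun m _ => m.natPred) ?_ ?_ ?_ ?_ ?_
  · intro m hm
    rw [Finset.mem_Iio, ← PNat.coe_lt_coe, hn]
    simpa using hm
  · intro m hm
    rw [Finset.mem_Iio, ← PNat.coe_lt_coe, hn] at hm
    have := PNat.natPred_add_one m
    exact Finset.mem_range.mpr (by omega)
  · simp
  · simp
  · simp

/-- The weight `φ j = (2 * M) ^ j` is admissible in `norm_entry_pow_le`. The resulting bound is
uniform in the exponent `k`, which matters because the rows of `P` and `P⁻¹` involve unbounded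
powers. -/
theorem norm_entry_pow_le_of_strictUpper {N : ColFin} {M : ℝ} (hM : 1 ≤ M)
    (h0 : ∀ i j, j ≤ i → entry N i j = 0)
    (h : ∀ i j, i < j → ‖entry N i j‖ ≤ M ^ ((j : ℕ) - i)) (k : ℕ) (i j : ℕ+) :
    ‖entry (N ^ k) i j‖ ≤ (2 * M) ^ (j : ℕ) := by
  refine norm_entry_pow_le (φ := fun j => (2 * M) ^ (j : ℕ))
    (fun j => one_le_pow₀ (by linarith)) (fun j => Finset.Iio j) (fun m j hm => ?_) (fun j => ?_) k i j
  · rw [Finset.mem_Iio]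
    by_contra hle
    exact hm (h0 _ _ (not_lt.mp hle))
  · calc _ ≤ ∑ m ∈ Finset.Iio j, (2 * M) ^ (m : ℕ) * M ^ ((j : ℕ) - m) :=
        Finset.sum_le_sum fun m hm => by
          have := h m j (Finset.mem_Iio.mp hm)
          gcongr
      _ ≤ ∑ m ∈ Finset.range j, (2 * M) ^ m * M ^ ((j : ℕ) - m) - _ :=
        sum_Iio_pnat j fun m => (2 * M) ^ m * M ^ ((j : ℕ) - m)
      _ ≤ ∑ m ∈ Finset.range j, (2 * M) ^ m * M ^ ((j : ℕ) - m) :=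
        sub_le_self _ (by positivity)
      _ ≤ _ := sum_pow_mul_two_pow_le (by linarith) j

/-! ### Exponential growth -/

/-- At most `(L + 1) * j` terms contribute to column `j`, each bounded exponentially in `j`. Only
one row of `A` enters, so the constant stays uniform when `A` varies with the row, as it does for
`P⁻¹`. Passing to `K + 1` and `L + 1` makes the bases at least `1`. -/
theorem norm_entry_mul_le {A B : ColFin} {K L : ℕ} {i : ℕ+}
    (hA : ∀ m, ‖entry A i m‖ ≤ (K : ℝ) ^ (m : ℕ)) (hB : ∀ i j, entry B i j ≠ 0 → (i : ℕ) ≤ L * j)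
    (hB' : ∀ i j, ‖entry B i j‖ ≤ (L : ℝ) ^ (j : ℕ)) (j : ℕ+) :
    ‖entry (A * B) i j‖ ≤ (2 * (L + 1 : ℝ) * (K + 1) ^ (L + 1) * (L + 1)) ^ (j : ℕ) := by
  obtain ⟨M, hM⟩ : ∃ M : ℕ+, (M : ℕ) = (L + 1) * j := ⟨⟨(L + 1) * j, by positivity⟩, rfl⟩
  rw [entry_mul (s := Finset.Icc 1 M) _ _ _ _ fun m hm => Finset.mem_Icc.mpr ⟨one_le, by
    rw [← PNat.coe_le_coe, hM]
    exact (hB m j hm).trans (Nat.mul_le_mul_right _ L.le_succ)⟩]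
  have hterm : ∀ m ∈ Finset.Icc 1 M, ‖entry A i m * entry B m j‖ ≤
      ((K + 1 : ℝ) ^ (L + 1)) ^ (j : ℕ) * (L + 1 : ℝ) ^ (j : ℕ) := by
    intro m hm
    have hm' := (Finset.mem_Icc.mp hm).2
    rw [← PNat.coe_le_coe, hM] at hm'
    rw [norm_mul, ← pow_mul]
    have hK : (1 : ℝ) ≤ (K : ℝ) + 1 := by linarith [K.cast_nonneg (α := ℝ)]
    refine mul_le_mul ((hA m).trans ?_) ((hB' m j).trans ?_) (norm_nonneg _) (by positivity)
    · calc (K : ℝ) ^ (m : ℕ) ≤ (K + 1 : ℝ) ^ (m : ℕ) := by gcongr; linarith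
        _ ≤ _ := pow_le_pow_right₀ hK hm'
    · gcongr; linarith
  refine (norm_sum_le_of_le _ hterm).trans ?_
  rw [Finset.sum_const, PNat.card_Icc, hM, nsmul_eq_mul]
  have h1 : (((L + 1) * (j : ℕ) + 1 - (1 : ℕ+) : ℕ) : ℝ) ≤ (2 * (L + 1 : ℝ)) ^ (j : ℕ) := by
    rw [PNat.one_coe, Nat.add_sub_cancel, mul_pow, mul_comm (2 ^ _)]
    push_cast
    have h2 : (j : ℝ) ≤ 2 ^ (j : ℕ) := by exact_mod_cast (Nat.lt_two_pow_self (n := j)).le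
    have h3 : (L + 1 : ℝ) ≤ (L + 1 : ℝ) ^ (j : ℕ) :=
      le_self_pow₀ (by linarith [L.cast_nonneg (α := ℝ)]) j.ne_zero
    gcongr
  calc _ ≤ (2 * (L + 1 : ℝ)) ^ (j : ℕ) *
        (((K + 1 : ℝ) ^ (L + 1)) ^ (j : ℕ) * (L + 1 : ℝ) ^ (j : ℕ)) := by gcongr
    _ = _ := by rw [← mul_pow, ← mul_pow, mul_assoc (2 * (L + 1 : ℝ))]

/-- The monoid of matrices whose columns have support of at most linearly growing size and entries
of at most exponentially growing size. -/
def expGrowth : Submonoid ColFin where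
  carrier := {A | ∃ K : ℕ, (∀ i j, entry A i j ≠ 0 → (i : ℕ) ≤ K * j) ∧
    ∀ i j, ‖entry A i j‖ ≤ (K : ℝ) ^ (j : ℕ)}
  one_mem' := ⟨1, fun i j h => by
      rw [entry_one] at h
      have : i = j := by by_contra hne; exact h (if_neg hne)
      rw [this, one_mul],
    fun i j => by rw [entry_one]; split_ifs <;> simp⟩
  mul_mem' := by
    rintro A B ⟨K, hA, hA'⟩ ⟨L, hB, hB'⟩
    -- The first summand bounds the entries, the summand `K * L` bounds the supports.
    refine ⟨2 * (L + 1) * (K + 1) ^ (L + 1) * (L + 1) + K * L, fun i j hij => ?_, fun i j => ?_⟩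
    · rw [entry_mul_support] at hij
      obtain ⟨m, -, hm⟩ := Finset.exists_ne_zero_of_sum_ne_zero hij
      have h1 := hA i m (left_ne_zero_of_mul hm)
      have h2 := hB m j (right_ne_zero_of_mul hm)
      calc (i : ℕ) ≤ K * (L * j) := h1.trans (Nat.mul_le_mul_left _ h2)
        _ ≤ _ := by rw [← mul_assoc]; exact Nat.mul_le_mul_right _ (Nat.le_add_left _ _)
    · refine (norm_entry_mul_le (hA' i) hB hB' j).trans ?_
      push_cast
      gcongr
      exact le_add_of_nonneg_right (by positivity)

theorem mem_expGrowth_of_le {A : ColFin} (c : ℕ) (hs : ∀ i j, entry A i j ≠ 0 → (i : ℕ) ≤ c * j)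
    {K : ℝ} (h : ∀ i j, ‖entry A i j‖ ≤ K ^ (j : ℕ)) : A ∈ expGrowth := by
  obtain ⟨L, hL⟩ := exists_nat_ge |K|
  refine ⟨c + L, fun i j hij => (hs i j hij).trans (Nat.mul_le_mul_right _ (by omega)),
    fun i j => (h i j).trans ?_⟩
  calc K ^ (j : ℕ) ≤ |K| ^ (j : ℕ) := by rw [← abs_pow]; exact le_abs_self _
    _ ≤ _ := by gcongr; push_cast; linarith [c.cast_nonneg (α := ℝ)]

theorem gammaInv_mem_expGrowth {X : Matrix (Fin 2) (Fin 2) ℂ⟦X⟧} (hX : ∀ a b, X a b ∈ expBounded) :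
    gammaInv X ∈ expGrowth := by
  obtain ⟨K, hK, hb⟩ := exists_common_bound hX
  have he : ∀ i j, entry (gammaInv X) i j = blockEntry X i j := fun i j => entry_ofMatrix _ _ i j
  -- A diagonal block reaches one place below the diagonal, so `i ≤ j + 1 ≤ 2 * j`.
  refine mem_expGrowth_of_le (K := K) 2 (fun i j hij => ?_) fun i j => ?_
  · have h := mem_blocksUpTo.mp (blockEntry_ne_zero (he i j ▸ hij))
    have hi := coe_eq_blockIndex i
    have hj := coe_eq_blockIndex j
    have := (blockIndex i).2.isLt
    omega
  · rw [he, blockEntry]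
    have hj := coe_eq_blockIndex j
    split_ifs
    · exact (hb _ _ _).trans (pow_le_pow_right₀ hK (by omega))
    · rw [norm_zero]; positivity

theorem v2_pow_le (j : ℕ+) : 2 ^ v2 j ≤ (j : ℕ) := Nat.ordProj_le 2 j.ne_zero

/-- If `j = d * 2 ^ (l - 1)` with `d` odd, then `2 ^ (l - 1) ≤ j`, so a quantity exponential in `l`
is polynomial in `j`. Likewise a linear bound on `k` in terms of `l` makes `d * 2 ^ (k - 1)`
polynomially bounded in `j`. -/
theorem psi_mem_DR0 {A : ColFin} (hA : A ∈ expGrowth) : psi A ∈ DR0 := by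
  obtain ⟨K, h1, h2⟩ := hA
  have he : ∀ i j, entry (psi A) i j = psiEntry A i j := fun i j => entry_ofMatrix _ _ i j
  have hKle : (K : ℝ) ≤ 2 ^ K := by exact_mod_cast Nat.lt_two_pow_self.le
  have hpos : ∀ j : ℕ+, (0 : ℝ) ≤ (j : ℝ) := fun j => Nat.cast_nonneg _
  refine ⟨2 ^ (K + 1), ((K + 1 : ℕ) : ℝ), by positivity, by positivity, fun i j hij => ?_,
    fun i j => ?_⟩
  · by_contra hne
    rw [he, psiEntry] at hne
    split_ifs at hne with hodd
    · have h := h1 _ _ hne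
      rw [Nat.succPNat_coe, Nat.succPNat_coe] at h
      refine absurd hij (not_lt.mpr ?_)
      rw [Real.rpow_natCast]
      have hi : (i : ℕ) = oddPart j * 2 ^ v2 i := by
        conv_lhs => rw [← oddPart_mul i, hodd]
        rw [PNat.mul_coe, PNat.pow_coe]; rfl
      have hj : (j : ℕ) = oddPart j * 2 ^ v2 j := by
        conv_lhs => rw [← oddPart_mul j]
        rw [PNat.mul_coe, PNat.pow_coe]; rfl
      have hv : v2 i ≤ (K + 1) + (K + 1) * v2 j := by
        have : v2 i + 1 ≤ K * v2 j + K := h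
        nlinarith
      -- The exponent is `K + 1` and not `K` because `K` may be `0`.
      have hd : (oddPart j : ℕ) ≤ (oddPart j : ℕ) ^ (K + 1) :=
        Nat.le_self_pow (Nat.succ_ne_zero K) _
      have : (i : ℕ) ≤ 2 ^ (K + 1) * (j : ℕ) ^ (K + 1) := by
        calc (i : ℕ) = oddPart j * 2 ^ v2 i := hi
          _ ≤ (oddPart j : ℕ) ^ (K + 1) * 2 ^ ((K + 1) + (K + 1) * v2 j) :=
            Nat.mul_le_mul hd (Nat.pow_le_pow_right two_pos hv)
          _ = 2 ^ (K + 1) * (oddPart j * 2 ^ v2 j) ^ (K + 1) := by ring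
          _ = _ := by rw [← hj]
      exact_mod_cast this
    · exact hne rfl
  · rw [he, psiEntry, Real.rpow_natCast]
    split_ifs
    · refine (h2 _ _).trans ?_
      rw [Nat.succPNat_coe]
      have hv : (2 : ℝ) ^ v2 j ≤ j := by exact_mod_cast v2_pow_le j
      calc (K : ℝ) ^ (v2 j + 1) ≤ (2 ^ K) ^ (v2 j + 1) := by gcongr
        _ = 2 ^ K * (2 ^ v2 j) ^ K := by ring
        _ ≤ 2 ^ (K + 1) * (j : ℝ) ^ (K + 1) := by
          have h1 : (2 : ℝ) ^ K ≤ 2 ^ (K + 1) := pow_le_pow_right₀ (by norm_num) K.le_succ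
          have h2 : (j : ℝ) ^ K ≤ (j : ℝ) ^ (K + 1) := pow_le_pow_right₀ (one_le_cast j) K.le_succ
          have h3 := pow_le_pow_left₀ (by positivity) hv K
          exact mul_le_mul h1 (h3.trans h2) (by positivity) (by positivity)
    · rw [norm_zero]
      have := hpos j
      positivity

/-! ### Toeplitz matrices -/

/-- The entries of the upper triangular Toeplitz matrix of a power series. -/
noncomputable def toeplitzEntry (a : ℂ⟦X⟧) (i j : ℕ+) : ℂ :=
  if i ≤ j then PowerSeries.coeff ((j : ℕ) - i) a else 0

theorem toeplitzEntry_finite (a : ℂ⟦X⟧) (j : ℕ+) :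
    (Function.support fun i => toeplitzEntry a i j).Finite :=
  (Set.finite_Iic j).subset fun _ hi => by
    by_contra hij
    exact hi (if_neg hij)

/-- The ring homomorphism taking a power series to its upper triangular Toeplitz matrix. -/
noncomputable def toeplitz : ℂ⟦X⟧ →+* ColFin where
  toFun a := ofMatrix (toeplitzEntry a) (toeplitzEntry_finite a)
  map_one' := ext_entry fun i j => by
    rw [entry_ofMatrix, entry_one, toeplitzEntry, PowerSeries.coeff_one]
    have : i = j ↔ i ≤ j ∧ (j : ℕ) - i = 0 := by
      rw [← PNat.coe_inj, ← PNat.coe_le_coe]; omega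
    simp only [this, ite_and]
  map_mul' a b := ext_entry fun i j => by
    -- Only `m` between `i` and `j` contribute. The indices below `i` are there to cover the support
    -- of column `j`; the entries of the left factor vanish on them.
    rw [entry_mul (s := Finset.Icc i j ∪ Finset.Iio i) _ _ _ _ fun m hm => by
      rw [entry_ofMatrix] at hm
      have : m ≤ j := by by_contra h; exact hm (if_neg h)
      rcases lt_or_ge m i with h | h
      · exact Finset.mem_union_right _ (Finset.mem_Iio.mpr h)
      · exact Finset.mem_union_left _ (Finset.mem_Icc.mpr ⟨h, this⟩)]
    simp only [entry_ofMatrix]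
    rw [← Finset.sum_subset Finset.subset_union_left]
    · by_cases hij : i ≤ j
      · rw [toeplitzEntry, if_pos hij, PowerSeries.coeff_mul,
          Finset.Nat.sum_antidiagonal_eq_sum_range_succ
            (fun k l => PowerSeries.coeff k a * PowerSeries.coeff l b)]
        have hij' : (i : ℕ) ≤ j := hij
        obtain ⟨f, hf⟩ : ∃ f : ℕ → ℕ+, ∀ k, (f k : ℕ) = i + k :=
          ⟨fun k => ⟨i + k, by positivity⟩, fun _ => rfl⟩
        refine Finset.sum_bij' (fun k _ => f k) (fun m _ => (m : ℕ) - i) ?_ ?_ ?_ ?_ ?_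
        · intro k hk
          have := Finset.mem_range.mp hk
          rw [Finset.mem_Icc, ← PNat.coe_le_coe, ← PNat.coe_le_coe, hf]
          omega
        · intro m hm
          rw [Finset.mem_Icc, ← PNat.coe_le_coe, ← PNat.coe_le_coe] at hm
          rw [Finset.mem_range]
          omega
        · intro k _
          rw [hf, Nat.add_sub_cancel_left]
        · intro m hm
          rw [Finset.mem_Icc, ← PNat.coe_le_coe, ← PNat.coe_le_coe] at hm
          apply PNat.coe_injective
          rw [hf]
          omega
        · intro k hk
          have := Finset.mem_range.mp hk
          rw [toeplitzEntry, toeplitzEntry, if_pos, if_pos, hf, Nat.add_sub_cancel_left,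
            Nat.sub_sub]
          · rw [← PNat.coe_le_coe, hf]; omega
          · rw [← PNat.coe_le_coe, hf]; omega
      · rw [toeplitzEntry, if_neg hij, Finset.Icc_eq_empty hij, Finset.sum_empty]
    · intro m hm hm'
      have : ¬ i ≤ m := fun h => by
        rcases Finset.mem_union.mp hm with h' | h'
        · exact hm' h'
        · exact absurd (Finset.mem_Iio.mp h') (not_lt.mpr h)
      rw [toeplitzEntry, if_neg this, zero_mul]
  map_zero' := ext_entry fun i j => by
    rw [entry_ofMatrix, entry_zero, toeplitzEntry]; simp
  map_add' a b := ext_entry fun i j => by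
    rw [entry_add]
    simp only [entry_ofMatrix, toeplitzEntry]
    split_ifs <;> simp

theorem entry_toeplitz (a : ℂ⟦X⟧) (i j : ℕ+) :
    entry (toeplitz a) i j = if i ≤ j then PowerSeries.coeff ((j : ℕ) - i) a else 0 :=
  entry_ofMatrix _ _ i j

theorem toeplitz_injective : Function.Injective toeplitz := by
  intro a b h
  ext n
  have := congrArg (fun A => entry A 1 n.succPNat) h
  simpa only [entry_toeplitz, if_pos (one_le : 1 ≤ n.succPNat), Nat.succPNat_coe, PNat.one_coe,
    Nat.succ_sub_one] using this

theorem toeplitz_X_row (i : ℕ+) : entry (toeplitz PowerSeries.X) i = entry 1 (i + 1) := by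
  funext j
  rw [entry_toeplitz, entry_one, PowerSeries.coeff_X, ← ite_and]
  congr 1
  rw [← PNat.coe_le_coe, ← PNat.coe_inj, PNat.add_coe, PNat.one_coe, eq_iff_iff]
  omega

theorem toeplitz_X_mul (A : ColFin) (i : ℕ+) :
    entry (toeplitz PowerSeries.X * A) i = entry A (i + 1) :=
  entry_mul_of_row_single (toeplitz_X_row i) A

/-- A matrix commuting with the shift is a Toeplitz matrix. -/
theorem exists_toeplitz_of_commute {A : ColFin} (h : Commute (toeplitz PowerSeries.X) A) :
    ∃ a, toeplitz a = A := by
  refine ⟨PowerSeries.mk fun n => entry A 1 n.succPNat, ext_row fun i => ?_⟩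
  induction i using PNat.recOn with
  | one =>
    funext j
    rw [entry_toeplitz, if_pos one_le, PowerSeries.coeff_mk]
    congr 1
    exact PNat.succPNat_natPred j
  | succ i ih =>
    -- Row `i + 1` is row `i` of the shift times the matrix; commuting with the shift therefore
    -- determines it from row `i`.
    rw [← toeplitz_X_mul, ← toeplitz_X_mul, h.eq, ← entry_mul_row_congr ih, ← map_mul, ← map_mul,
      mul_comm]

theorem toeplitz_mem_expGrowth {a : ℂ⟦X⟧} (ha : a ∈ expBounded) : toeplitz a ∈ expGrowth := by
  obtain ⟨K, hK, ha⟩ := ha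
  refine mem_expGrowth_of_le (K := K) 1 (fun i j hij => ?_) fun i j => ?_
  · rw [entry_toeplitz] at hij
    rw [one_mul, PNat.coe_le_coe]
    by_contra h
    exact hij (if_neg h)
  · rw [entry_toeplitz]
    have := i.pos
    have := j.pos
    split_ifs
    · exact (ha _).trans (pow_le_pow_right₀ hK (by omega))
    · rw [norm_zero]; positivity

theorem norm_toeplitz_pow_le {a : ℂ⟦X⟧} (ha : a ∈ expBounded)
    (h0 : PowerSeries.constantCoeff a = 0) :
    ∃ L : ℕ, ∀ (k : ℕ) (i j : ℕ+), ‖entry (toeplitz a ^ k) i j‖ ≤ (L : ℝ) ^ (j : ℕ) := by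
  obtain ⟨M, hM, ha⟩ := exists_pow_bound ha
  obtain ⟨L, hL⟩ := exists_nat_ge (2 * M)
  refine ⟨L, fun k i j => (norm_entry_pow_le_of_strictUpper hM (fun i j hij => ?_)
    (fun i j hij => ?_) k i j).trans (by gcongr)⟩
  · rw [entry_toeplitz]
    split_ifs with h
    · rw [le_antisymm h hij, Nat.sub_self, PowerSeries.coeff_zero_eq_constantCoeff_apply, h0]
    · rfl
  · rw [entry_toeplitz, if_pos hij.le]
    have : (i : ℕ) < j := hij
    exact ha _ (by omega)

theorem entry_gammaInv (X : Matrix (Fin 2) (Fin 2) ℂ⟦X⟧) (i j : ℕ+) :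
    entry (gammaInv X) i j = blockEntry X i j :=
  entry_ofMatrix _ _ i j

/-! ### The matrix `P` and its inverse -/

/-- The matrix `γ(J̃) - 1`. -/
noncomputable def Jt' : Matrix (Fin 2) (Fin 2) ℂ⟦X⟧ :=
  !![0, 1 + gSeries; gSeries, PowerSeries.X]

theorem Jt_eq : (Jt : Matrix (Fin 2) (Fin 2) ℂ⟦X⟧) = Jt' + 1 := by
  rw [Matrix.one_fin_two]
  ext i j : 1
  fin_cases i <;> fin_cases j <;> simp [Jt, Jt', add_comm]

theorem gammaInv_Jt' : gammaInv Jt' = Jtilde - 1 := by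
  rw [Jtilde, Jt_eq, map_add, map_one]
  exact (add_sub_cancel_right (gammaInv Jt') 1).symm

theorem Jt'_mem_expBounded (a b : Fin 2) : Jt' a b ∈ expBounded := by
  have hg := gSeries_mem_expBounded
  have hX := X_mem_expBounded
  have h1 := add_mem expBounded.one_mem hg
  fin_cases a <;> fin_cases b <;> simp [Jt', hg, hX, h1]

/-- Cayley-Hamilton: `Jt'` has trace `t` and determinant `-(g^2 + g) = -t`. -/
theorem Jt'_mul_self : Jt' * Jt' = Matrix.scalar (Fin 2) PowerSeries.X * (Jt' + 1) := by
  have hg := gSeries_sq_add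
  rw [Matrix.scalar_apply, ← Matrix.smul_eq_diagonal_mul, Matrix.one_fin_two]
  ext i j : 1
  fin_cases i <;> fin_cases j <;>
    simp only [Jt', Matrix.mul_fin_two, Matrix.smul_apply, smul_eq_mul, Matrix.add_apply,
      Matrix.of_apply, Fin.zero_eta, Fin.mk_one,
      Matrix.cons_val', Matrix.cons_val_zero, Matrix.cons_val_one, Matrix.cons_val_fin_one]
  · linear_combination hg
  · ring
  · ring
  · linear_combination hg

theorem entry_matP (i j : ℕ+) : entry (matP : ColFin) i j = pEntry i j :=
  entry_unitOfUpper _ _ i j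

theorem matP_upper : IsUpperUnitriangular (entry (matP : ColFin)) := by
  have : entry (matP : ColFin) = pEntry := by
    funext i j; exact entry_matP i j
  exact this ▸ pEntry_upper

theorem matP_row (i : ℕ+) : entry (matP : ColFin) i = entry (gammaInv Jt' ^ ((i : ℕ) - 1)) 1 := by
  funext j
  rw [entry_matP, pEntry, gammaInv_Jt']

theorem matP_row_one : entry (matP : ColFin) 1 = entry 1 1 := by
  rw [matP_row]; simp

theorem norm_gammaInv_Jt'_pow_le :
    ∃ L : ℝ, ∀ (k : ℕ) (i j : ℕ+), ‖entry (gammaInv Jt' ^ k) i j‖ ≤ L ^ (j : ℕ) := by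
  obtain ⟨K, hK, hb⟩ := exists_common_bound Jt'_mem_expBounded
  -- For `i < j` in blocks `s ≤ r` one has `r - s + 1 ≤ 2 * (j - i)`, which turns the coefficient
  -- bound into `(K ^ 2) ^ (j - i)`.
  refine ⟨2 * K ^ 2, fun k i j => norm_entry_pow_le_of_strictUpper (one_le_pow₀ hK)
    (fun i j hij => ?_) (fun i j hij => ?_) k i j⟩
  · have hi := coe_eq_blockIndex i
    have hj := coe_eq_blockIndex j
    have hij' : (j : ℕ) ≤ i := hij
    rw [entry_gammaInv, blockEntry]
    generalize blockIndex i = p at *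
    generalize blockIndex j = q at *
    obtain ⟨s, a⟩ := p
    obtain ⟨r, b⟩ := q
    dsimp only at *
    split_ifs with h
    · have ha := a.isLt
      obtain rfl : s = r := by omega
      have hba : b ≤ a := Fin.le_def.mpr (by omega)
      have hg := constantCoeff_gSeries
      clear hi hj
      fin_cases a <;> fin_cases b <;> first | exact absurd hba (by decide) | simp [Jt', hg]
    · rfl
  · have hi := coe_eq_blockIndex i
    have hj := coe_eq_blockIndex j
    have hij' : (i : ℕ) < j := hij
    have ha := (blockIndex i).2.isLt
    rw [entry_gammaInv, blockEntry]
    split_ifs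
    · refine (hb _ _ _).trans ?_
      rw [← pow_mul]
      exact pow_le_pow_right₀ hK (by omega)
    · rw [norm_zero]; positivity

theorem matP_mem_expGrowth : (matP : ColFin) ∈ expGrowth := by
  obtain ⟨L, hL⟩ := norm_gammaInv_Jt'_pow_le
  refine mem_expGrowth_of_le (K := L) 1 (fun i j hij => ?_) fun i j => ?_
  · rw [one_mul, PNat.coe_le_coe]
    by_contra h
    exact hij (matP_upper.1 i j (not_le.mp h))
  · rw [matP_row]; exact hL _ _ _

/-- Row `i + 1` of `P` is row `i` times `γ⁻¹(Jt')`, so conjugation by `P` carries `γ⁻¹(Jt')` to the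
shift. -/
theorem toeplitz_X_mul_matP :
    toeplitz PowerSeries.X * (matP : ColFin) = (matP : ColFin) * gammaInv Jt' := by
  refine ext_row fun i => ?_
  rw [toeplitz_X_mul, matP_row, entry_mul_row_congr (matP_row i), ← pow_succ, PNat.add_coe,
    PNat.one_coe, Nat.add_sub_cancel, Nat.sub_add_cancel i.pos]

/-- The homomorphism `X ↦ P * γ⁻¹(X) * P⁻¹`. -/
noncomputable def conjP : Matrix (Fin 2) (Fin 2) ℂ⟦X⟧ →+* ColFin where
  toFun X := matP * gammaInv X * (matP⁻¹ : ColFinˣ)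
  map_one' := by rw [map_one, mul_one, Units.mul_inv]
  map_mul' X Y := by
    rw [map_mul]
    simp only [mul_assoc, Units.inv_mul_cancel_left]
  map_zero' := by simp
  map_add' X Y := by rw [map_add, mul_add, add_mul]

theorem conjP_apply (X : Matrix (Fin 2) (Fin 2) ℂ⟦X⟧) :
    conjP X = matP * gammaInv X * (matP⁻¹ : ColFinˣ) := rfl

theorem conjP_Jt' : conjP Jt' = toeplitz PowerSeries.X := by
  rw [conjP_apply, ← toeplitz_X_mul_matP, Units.mul_inv_cancel_right]

/-- Scalar matrices commute with `Jt'`, so their images commute with the shift. -/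
theorem exists_toeplitz_conjP (z : ℂ⟦X⟧) :
    ∃ a, toeplitz a = conjP (Matrix.scalar (Fin 2) z) := by
  refine exists_toeplitz_of_commute ?_
  rw [← conjP_Jt']
  exact (Matrix.scalar_commute z (Commute.all z) Jt').symm.map conjP

/-- The rows of `P⁻¹` are products of powers of one exponentially bounded series without constant
term with one of two exponentially bounded series. -/
theorem exists_inv_matP_row : ∃ f h : ℂ⟦X⟧, f ∈ expBounded ∧ PowerSeries.constantCoeff f = 0 ∧
    h ∈ expBounded ∧ ∀ i : ℕ+, entry ((matP⁻¹ : ColFinˣ) : ColFin) i =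
      entry (toeplitz f ^ (blockIndex i).1 *
        toeplitz (if (blockIndex i).2 = 0 then 1 else PowerSeries.X * h)) 1 := by
  obtain ⟨k, hk⟩ : ∃ k, (1 + gSeries) * k = 1 := by
    refine IsUnit.exists_right_inv (PowerSeries.isUnit_iff_constantCoeff.mpr ?_)
    rw [map_add, map_one, constantCoeff_gSeries, add_zero]
    exact isUnit_one
  obtain ⟨f, hf⟩ := exists_toeplitz_conjP PowerSeries.X
  obtain ⟨G, hG⟩ := exists_toeplitz_conjP gSeries
  obtain ⟨h, hh⟩ := exists_toeplitz_conjP k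
  -- The Cayley-Hamilton relation transported by `conjP`: the image of `t` is the Toeplitz matrix of
  -- `f = X^2 / (1 + X)`.
  have e1 : PowerSeries.X * PowerSeries.X = f * (1 + PowerSeries.X) := by
    apply toeplitz_injective
    rw [map_mul, map_mul, map_add, hf, ← conjP_Jt', ← map_mul, Jt'_mul_self, map_mul, map_add,
      map_one, map_one, add_comm]
  have e2 : G ^ 2 + G = f := by
    apply toeplitz_injective
    rw [map_add, map_pow, hf, hG, ← map_pow, ← map_pow, ← map_add, ← map_add, gSeries_sq_add]
  have e3 : (1 + G) * h = 1 := by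
    apply toeplitz_injective
    rw [map_mul, map_add, hG, hh, map_one, ← map_one conjP, ← map_one (Matrix.scalar (Fin 2)),
      ← map_add, ← map_add, ← map_mul, ← map_mul, hk]
  have f0 : PowerSeries.constantCoeff f = 0 := by
    have := congrArg PowerSeries.constantCoeff e1
    simpa using this.symm
  have G0 : PowerSeries.constantCoeff G = 0 := by
    have h1 := congrArg PowerSeries.constantCoeff e2
    have h2 := congrArg PowerSeries.constantCoeff e3
    simp only [map_add, map_mul, map_pow, map_one, f0] at h1 h2
    have h3 : PowerSeries.constantCoeff G * (1 + PowerSeries.constantCoeff G) = 0 := by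
      linear_combination h1
    -- Of the roots `0` and `-1`, the second is excluded because `1 + G` is invertible.
    exact (mul_eq_zero.mp h3).resolve_right (left_ne_zero_of_mul_eq_one h2)
  have hX := X_mem_expBounded
  have fE : f ∈ expBounded := by
    obtain ⟨u, hu⟩ : ∃ u : ℂ⟦X⟧, (1 + PowerSeries.X) * u = 1 := by
      refine IsUnit.exists_right_inv (PowerSeries.isUnit_iff_constantCoeff.mpr ?_)
      simp
    have : f = PowerSeries.X * PowerSeries.X * u := by
      linear_combination -u * e1 - f * hu
    rw [this]
    exact mul_mem (mul_mem hX hX)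
      (expBounded_of_mul_eq_one (add_mem (one_mem _) hX) (by simp) hu)
  have GE : G ∈ expBounded := by
    -- Completing the square in `G^2 + G = f` reduces `G` to a square root.
    have h1 : 1 + 2 * G ∈ expBounded := by
      refine expBounded_of_sq ?_ (by simp [G0])
      rw [show (1 + 2 * G) ^ 2 = 1 + 4 * f by linear_combination 4 * e2]
      exact add_mem (one_mem _) (mul_mem (natCast_mem expBounded 4) fE)
    have h2 : G = PowerSeries.C (1 / 2 : ℂ) * (1 + 2 * G - 1) := by
      have : PowerSeries.C (1 / 2 : ℂ) * 2 = 1 := by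
        rw [← map_ofNat (PowerSeries.C (R := ℂ)) 2, ← map_mul]; norm_num
      linear_combination -G * this
    rw [h2]
    exact mul_mem (C_mem_expBounded _) (sub_mem h1 (one_mem _))
  have hE : h ∈ expBounded :=
    expBounded_of_mul_eq_one (add_mem (one_mem _) GE) (by simp [G0]) e3
  refine ⟨f, h, fE, f0, hE, fun i => ?_⟩
  -- `R` is chosen so that the first row of `γ⁻¹(R)` is the `i`-th unit row: the power of `t`
  -- selects the block, and `Jt' * k` has first row `(0, 1)`. The first row of `P` being the first
  -- unit row, row `i` of `P⁻¹` is the first row of `conjP R`.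
  set R : Matrix (Fin 2) (Fin 2) ℂ⟦X⟧ := Matrix.scalar (Fin 2) PowerSeries.X ^ (blockIndex i).1 *
    (if (blockIndex i).2 = 0 then 1 else Jt' * Matrix.scalar (Fin 2) k) with hR
  have hrow : entry (gammaInv R) 1 = entry 1 i := by
    funext j
    have h1 : blockIndex 1 = (0, 0) := rfl
    have hij : i = j ↔ blockIndex i = blockIndex j := blockIndex.injective.eq_iff.symm
    rw [entry_gammaInv, blockEntry, h1, if_pos (Nat.zero_le _), entry_one, Nat.sub_zero, hR,
      ← map_pow, Matrix.scalar_apply, ← Matrix.smul_eq_diagonal_mul, Matrix.smul_apply,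
      smul_eq_mul]
    simp only [hij]
    generalize blockIndex i = p
    generalize blockIndex j = q
    obtain ⟨s, a⟩ := p
    obtain ⟨r, b⟩ := q
    have hent : (if a = 0 then 1 else Jt' * Matrix.scalar (Fin 2) k :
        Matrix (Fin 2) (Fin 2) ℂ⟦X⟧) 0 b = if a = b then 1 else 0 := by
      fin_cases a <;> fin_cases b <;> simp [Jt', hk, Matrix.one_apply]
    dsimp only
    rw [hent]
    simp only [Prod.mk.injEq]
    by_cases hab : a = b
    · simp [hab, PowerSeries.coeff_X_pow, eq_comm]
    · simp [hab]
  have hc : conjP R = toeplitz f ^ (blockIndex i).1 *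
      toeplitz (if (blockIndex i).2 = 0 then 1 else PowerSeries.X * h) := by
    rw [hR, map_mul, map_pow, hf]
    split_ifs
    · rw [map_one, map_one]
    · rw [map_mul, map_mul, conjP_Jt', hh]
  rw [← hc, conjP_apply, mul_assoc, entry_mul_of_row_single matP_row_one,
    entry_mul_of_row_single hrow]

theorem inv_matP_mem_expGrowth : ((matP⁻¹ : ColFinˣ) : ColFin) ∈ expGrowth := by
  obtain ⟨f, h, hf, hf0, hh, hrow⟩ := exists_inv_matP_row
  obtain ⟨L, hL⟩ := norm_toeplitz_pow_le hf hf0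
  obtain ⟨K, hK, hK'⟩ := toeplitz_mem_expGrowth (mul_mem X_mem_expBounded hh)
  refine mem_expGrowth_of_le
    (K := max L (2 * (K + 1 : ℝ) * (L + 1) ^ (K + 1) * (K + 1))) 1 (fun i j hij => ?_) fun i j => ?_
  · rw [one_mul, PNat.coe_le_coe]
    by_contra hlt
    exact hij (entry_inv_of_lt matP_upper (not_le.mp hlt))
  · rw [hrow]
    split_ifs
    · rw [map_one, mul_one]
      exact (hL _ _ _).trans (pow_le_pow_left₀ (Nat.cast_nonneg _) (le_max_left _ _) _)
    · exact (norm_entry_mul_le (hL _ 1) hK hK' j).trans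
        (pow_le_pow_left₀ (by positivity) (le_max_right _ _) _)

/-! ### Integrality of `P` -/

/-- The ring of power series with integer coefficients. -/
noncomputable def integerSeries : Subring ℂ⟦X⟧ :=
  (PowerSeries.map (Int.castRingHom ℂ)).range

theorem gammaInv_mem_integerMatrices {X : Matrix (Fin 2) (Fin 2) ℂ⟦X⟧}
    (hX : ∀ a b, X a b ∈ integerSeries) : gammaInv X ∈ integerMatrices := by
  intro i j
  rw [entry_gammaInv, blockEntry]
  split_ifs
  · obtain ⟨x, hx⟩ := hX (blockIndex i).2 (blockIndex j).2
    rw [← hx, PowerSeries.coeff_map]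
    exact ⟨_, rfl⟩
  · exact ⟨0, by simp⟩

theorem gSeries_mem_integerSeries : gSeries ∈ integerSeries := by
  refine sub_mem ⟨PowerSeries.mk fun n => match n with
    | 0 => 1
    | n + 1 => (-1) ^ n * catalan n, ?_⟩ (one_mem _)
  ext n
  rw [PowerSeries.coeff_map, PowerSeries.coeff_mk, PowerSeries.coeff_mk]
  rcases n with _ | n <;> simp [bSeq]

theorem gammaInv_Jt'_mem_integerMatrices : gammaInv Jt' ∈ integerMatrices := by
  refine gammaInv_mem_integerMatrices fun a b => ?_
  have hg := gSeries_mem_integerSeries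
  have hX : PowerSeries.X ∈ integerSeries := ⟨PowerSeries.X, PowerSeries.map_X _⟩
  have h1 := add_mem integerSeries.one_mem hg
  fin_cases a <;> fin_cases b <;> simp [Jt', hg, hX, h1]

theorem gammaInv_St_mem_integerMatrices : gammaInv St.1 ∈ integerMatrices := by
  refine gammaInv_mem_integerMatrices fun a b => ?_
  fin_cases a <;> fin_cases b <;> simp [St]

theorem matP_mem_integerMatrices : (matP : ColFin) ∈ integerMatrices := by
  intro i j
  rw [matP_row]
  exact pow_mem gammaInv_Jt'_mem_integerMatrices _ 1 j

theorem not_isIntegerMatrix_gammaInv_Wt : ¬ IsIntegerMatrix (gammaInv Wt) := by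
  intro h
  obtain ⟨n, hn⟩ := h (blockIndex.symm (0, 0)) (blockIndex.symm (3, 0))
  rw [entry_gammaInv, blockEntry, Equiv.apply_symm_apply, Equiv.apply_symm_apply,
    if_pos (Nat.zero_le _), Nat.sub_zero, coeff_Wt] at hn
  have h2 : ((-11 : ℤ) : ℂ) = ((2 * n : ℤ) : ℂ) := by
    push_cast
    rw [← hn]
    norm_num
  have h3 : (-11 : ℤ) = 2 * n := by exact_mod_cast h2
  omega

/-! ### The doubling matrix -/

theorem not_two_dvd_oddPart (i : ℕ+) : ¬ 2 ∣ (oddPart i : ℕ) :=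
  Nat.not_dvd_ordCompl Nat.prime_two i.ne_zero

theorem v2_eq_zero {i : ℕ+} (h : ¬ 2 ∣ (i : ℕ)) : v2 i = 0 :=
  Nat.factorization_eq_zero_of_not_dvd h

theorem v2_mul (i j : ℕ+) : v2 (i * j) = v2 i + v2 j := by
  rw [v2, PNat.mul_coe, Nat.factorization_mul i.ne_zero j.ne_zero]; rfl

theorem v2_mul_two (i : ℕ+) : v2 (i * 2) = v2 i + 1 := by
  rw [v2_mul]
  congr 1
  exact Nat.prime_two.factorization_self

theorem oddPart_of_v2_eq_zero {i : ℕ+} (h : v2 i = 0) : oddPart i = i := by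
  have := oddPart_mul i
  rwa [h, pow_zero, mul_one] at this

theorem oddPart_mul_two (i : ℕ+) : oddPart (i * 2) = oddPart i := by
  have h := oddPart_mul (i * 2)
  rw [v2_mul_two, pow_succ, ← mul_assoc] at h
  have h' := mul_right_cancel h
  conv_rhs at h' => rw [← oddPart_mul i]
  exact mul_right_cancel h'

instance decidableDvd : DecidableRel ((· ∣ ·) : ℕ+ → ℕ+ → Prop) := fun _ _ =>
  decidable_of_iff _ PNat.dvd_iff.symm

theorem dvd_mul_two_iff {i j : ℕ+} : i * 2 ∣ j * 2 ↔ i ∣ j := by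
  rw [PNat.dvd_iff, PNat.dvd_iff, PNat.mul_coe, PNat.mul_coe]
  exact Nat.mul_dvd_mul_iff_right two_pos

/-- The matrix whose `i`-th row has its only nonzero entry, a `1`, in column `2 * i`. -/
noncomputable def doubling : ColFin :=
  ofMatrix (fun i j => if i * 2 = j then 1 else 0) fun j =>
    (Set.finite_Iic j).subset fun i hi => by
      by_contra hij
      refine hi (if_neg ?_)
      rintro rfl
      exact hij (Set.mem_Iic.mpr (le_mul_of_one_le_right' one_le))

theorem doubling_row (i : ℕ+) : entry doubling i = entry 1 (i * 2) := by
  funext j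
  rw [doubling, entry_ofMatrix, entry_one]

theorem doubling_mul (A : ColFin) (i : ℕ+) : entry (doubling * A) i = entry A (i * 2) :=
  entry_mul_of_row_single (doubling_row i) A

theorem doubling_pow_mul (k : ℕ) (A : ColFin) (i : ℕ+) :
    entry (doubling ^ k * A) i = entry A (i * 2 ^ k) := by
  induction k generalizing i with
  | zero => rw [pow_zero, pow_zero, one_mul, mul_one]
  | succ k ih => rw [pow_succ', mul_assoc, doubling_mul, ih, pow_succ', mul_assoc]

theorem doubling_pow_v2_mul (A : ColFin) (i : ℕ+) :
    entry (doubling ^ v2 i * A) (oddPart i) = entry A i := by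
  rw [doubling_pow_mul, oddPart_mul]

theorem isUnit_one_add_doubling : IsUnit (1 + doubling) := by
  refine isUnit_of_upper ⟨fun i j hij => ?_, fun i => ?_⟩
  · rw [entry_add, doubling_row, entry_one, entry_one, if_neg hij.ne', if_neg, add_zero]
    rintro rfl
    exact absurd hij (not_lt.mpr (le_mul_of_one_le_right' one_le))
  · rw [entry_add, doubling_row, entry_one, entry_one, if_pos rfl, if_neg, add_zero]
    intro h
    have := congrArg v2 h
    rw [v2_mul_two] at this
    omega

/-! ### The divisor matrix -/

theorem entry_divisorMatrix (i j : ℕ+) : entry divisorMatrix i j = if i ∣ j then 1 else 0 := by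
  rw [divisorMatrix, entry_ofMatrix]
  simp only [PNat.dvd_iff]

/-- Both matrices represent multiplication by Dirichlet series, `ζ(s)` and `2^(-s)`. -/
theorem commute_divisorMatrix_doubling : Commute divisorMatrix doubling := by
  refine ext_entry fun i j => ?_
  rw [doubling_mul]
  have he : ∀ m, entry doubling m j = if m * 2 = j then 1 else 0 := fun m => entry_ofMatrix _ _ m j
  by_cases hj : ∃ m, m * 2 = j
  · obtain ⟨m, rfl⟩ := hj
    rw [entry_mul (s := {m}), Finset.sum_singleton, he, if_pos rfl, mul_one, entry_divisorMatrix,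
      entry_divisorMatrix]
    · simp only [dvd_mul_two_iff]
    · intro k hk
      rw [he] at hk
      by_contra hkm
      exact hk (if_neg fun h => hkm (Finset.mem_singleton.mpr (mul_right_cancel h)))
  · rw [entry_mul (s := ∅), Finset.sum_empty, entry_divisorMatrix, if_neg]
    · rintro ⟨c, rfl⟩
      exact hj ⟨i * c, mul_right_comm _ _ _⟩
    · intro k hk
      rw [he] at hk
      exact absurd (if_neg fun h => hj ⟨k, h⟩) hk

/-- The matrix of multiplication by `∑ d ^ (-s)`, with `d > 1` odd, on Dirichlet series. -/
noncomputable def oddDivisors : ColFin := divisorMatrix - doubling * divisorMatrix - 1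

theorem entry_oddDivisors (i j : ℕ+) : entry oddDivisors i j =
    (if i ∣ j then 1 else 0) - (if i * 2 ∣ j then 1 else 0) - if i = j then 1 else 0 := by
  rw [oddDivisors, entry_sub, entry_sub, doubling_mul, entry_divisorMatrix, entry_divisorMatrix,
    entry_one]

theorem commute_oddDivisors_doubling : Commute oddDivisors doubling := by
  have h := commute_divisorMatrix_doubling
  have h1 : Commute 1 doubling := Commute.one_left _
  exact Commute.sub_left (R := ColFin) (Commute.sub_left (R := ColFin) h ((Commute.refl _).mul_left h)) h1

theorem commute_oddDivisors_divisorMatrix : Commute oddDivisors divisorMatrix := by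
  have h := commute_divisorMatrix_doubling
  have h0 : Commute divisorMatrix divisorMatrix := Commute.refl _
  have h1 : Commute 1 divisorMatrix := Commute.one_left _
  exact Commute.sub_left (R := ColFin) (Commute.sub_left (R := ColFin) h0 (h.symm.mul_left h0)) h1

/-! ### The matrix `Z` and its inverse -/

theorem entry_matZ (i j : ℕ+) : entry (matZ : ColFin) i j = zEntry i j :=
  entry_unitOfUpper _ _ i j

theorem matZ_upper : IsUpperUnitriangular (entry (matZ : ColFin)) := by
  have : entry (matZ : ColFin) = zEntry := by
    funext i j; exact entry_matZ i j
  exact this ▸ zEntry_upper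

theorem matZ_row (i : ℕ+) :
    entry (matZ : ColFin) i = entry ((divisorMatrix - 1) ^ v2 i) (oddPart i) := by
  funext j
  rw [entry_matZ, zEntry]

theorem matZ_row_of_odd {i : ℕ+} (h : ¬ 2 ∣ (i : ℕ)) : entry (matZ : ColFin) i = entry 1 i := by
  rw [matZ_row, v2_eq_zero h, pow_zero, oddPart_of_v2_eq_zero (v2_eq_zero h)]

/-- Passing from `i` to `2i` keeps the odd part and raises the exponent of `D - 1` by one. -/
theorem doubling_mul_matZ :
    doubling * (matZ : ColFin) = (matZ : ColFin) * (divisorMatrix - 1) := by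
  refine ext_row fun i => ?_
  rw [doubling_mul, matZ_row, entry_mul_row_congr (matZ_row i), ← pow_succ, v2_mul_two,
    oddPart_mul_two]

theorem doubling_pow_mul_matZ (k : ℕ) :
    doubling ^ k * (matZ : ColFin) = (matZ : ColFin) * (divisorMatrix - 1) ^ k :=
  ((show SemiconjBy (matZ : ColFin) (divisorMatrix - 1) doubling from
    doubling_mul_matZ.symm).pow_right k).symm

/-- For odd `d`, row `d` of `oddDivisors` is supported on odd columns, and the odd rows of `Z` are
those of the identity. -/
theorem oddDivisors_mul_matZ_row {d : ℕ+} (hd : ¬ 2 ∣ (d : ℕ)) :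
    entry (oddDivisors * (matZ : ColFin)) d = entry oddDivisors d := by
  funext j
  conv_rhs => rw [← mul_one oddDivisors]
  rw [entry_mul (s := Finset.Iic j) _ (matZ : ColFin), entry_mul (s := Finset.Iic j) _ 1]
  · refine Finset.sum_congr rfl fun m _ => ?_
    by_cases hm : 2 ∣ (m : ℕ)
    · have h0 : entry oddDivisors d m = 0 := by
        have hdm : d ≠ m := by rintro rfl; exact hd hm
        have hiff : d * 2 ∣ m ↔ d ∣ m := by
          rw [PNat.dvd_iff, PNat.dvd_iff, PNat.mul_coe]
          refine ⟨fun h => (Nat.dvd_mul_right _ _).trans h, fun h => ?_⟩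
          exact Nat.Coprime.mul_dvd_of_dvd_of_dvd
            (Nat.prime_two.coprime_iff_not_dvd.mpr hd).symm h hm
        rw [entry_oddDivisors, if_neg hdm]
        simp only [hiff, sub_self]
      rw [h0, zero_mul, zero_mul]
    · rw [matZ_row_of_odd hm]
  · intro m hm
    rw [entry_one] at hm
    by_contra h
    exact hm (if_neg fun h' => h (Finset.mem_Iic.mpr h'.le))
  · intro m hm
    by_contra h
    exact hm (matZ_upper.1 _ _ (not_le.mp fun h' => h (Finset.mem_Iic.mpr h')))

/-- Rows of odd index are settled by `oddDivisors_mul_matZ_row`. Row `2^k d` is reached by `doubling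
^ k`, which becomes `(D - 1) ^ k` on the other side of `Z`; `oddDivisors` commutes with both. -/
theorem commute_oddDivisors_matZ : Commute oddDivisors (matZ : ColFin) := by
  refine ext_row fun i => ?_
  have h1 : Commute oddDivisors 1 := Commute.one_right _
  have h : Commute oddDivisors (divisorMatrix - 1) :=
    Commute.sub_right (R := ColFin) commute_oddDivisors_divisorMatrix h1
  rw [← doubling_pow_v2_mul, ← mul_assoc, ← (commute_oddDivisors_doubling.pow_right _).eq,
    mul_assoc, doubling_pow_mul_matZ, ← mul_assoc,
    entry_mul_row_congr (oddDivisors_mul_matZ_row (not_two_dvd_oddPart i)),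
    (h.pow_right _).eq, ← entry_mul_row_congr (matZ_row i)]

/-- The matrix of multiplication by `-∑ (-1) ^ v2 n * n ^ (-s)`, with `n > 1`, on Dirichlet
series. -/
noncomputable def signedDivisors : ColFin :=
  ofMatrix (fun i j => if i ∣ j ∧ i ≠ j then -(-1) ^ (v2 i + v2 j) else 0) fun j =>
    (Set.finite_Iic j).subset fun i hi => by
      by_contra hij
      exact hi (if_neg fun h => hij (Nat.le_of_dvd j.pos (PNat.dvd_iff.mp h.1)))

theorem entry_signedDivisors (i j : ℕ+) : entry signedDivisors i j =
    if i ∣ j ∧ i ≠ j then -(-1) ^ (v2 i + v2 j) else 0 :=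
  entry_ofMatrix _ _ i j

/-- With `x = 2^(-s)` and `o` for `oddDivisors`, the signed series is `1 - (1+o)/(1+x) =
(x-o)/(1+x)`. -/
theorem one_add_doubling_mul_signedDivisors :
    (1 + doubling) * signedDivisors = doubling - oddDivisors := by
  refine ext_entry fun i j => ?_
  rw [add_mul, one_mul, entry_add, doubling_mul, entry_sub, entry_oddDivisors, doubling_row,
    entry_one, entry_signedDivisors, entry_signedDivisors]
  have hne : i * 2 ≠ i := fun h => by
    have := congrArg v2 h
    rw [v2_mul_two] at this
    omega
  have hdvd : i * 2 ∣ j → i ∣ j := fun h => (Dvd.intro _ rfl).trans h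
  by_cases h1 : i ∣ j
  · by_cases h2 : i * 2 ∣ j
    · have h3 : i ≠ j := by
        rintro rfl
        exact hne (PNat.dvd_antisymm h2 (Dvd.intro _ rfl))
      have hs : (-1 : ℂ) ^ (v2 i + 1 + v2 j) = -(-1) ^ (v2 i + v2 j) := by ring
      by_cases h4 : i * 2 = j
      · subst h4
        rw [v2_mul_two, show v2 i + (v2 i + 1) = 2 * v2 i + 1 by ring, pow_succ, pow_mul]
        simp [h1, h3]
      · rw [v2_mul_two, hs]
        simp [h1, h2, h3, h4]
    · have h4 : i * 2 ≠ j := by rintro rfl; exact h2 dvd_rfl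
      by_cases h3 : i = j
      · subst h3
        simp [h2, h4]
      · obtain ⟨c, rfl⟩ := h1
        have hc : ¬ 2 ∣ (c : ℕ) := by
          rintro ⟨e, he⟩
          refine h2 (PNat.dvd_iff.mpr ⟨e, ?_⟩)
          rw [PNat.mul_coe, PNat.mul_coe, he, mul_assoc]; rfl
        rw [v2_mul i c, v2_eq_zero hc, add_zero, ← two_mul, pow_mul]
        simp [h2, h3, h4]
  · have h2 : ¬ i * 2 ∣ j := fun h => h1 (hdvd h)
    have h3 : i ≠ j := by rintro rfl; exact h1 dvd_rfl
    have h4 : i * 2 ≠ j := by rintro rfl; exact h2 dvd_rfl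
    simp [h1, h2, h3, h4]

/-- From `D(1-x) = 1+o` one gets `Dx = D-1-o`, hence `Z D x = (x-o) Z`. Since `Z D = (1+x) Z`,
cancelling the unit `1+x` gives the claim. -/
theorem matZ_mul_doubling :
    (matZ : ColFin) * doubling = signedDivisors * (matZ : ColFin) := by
  refine isUnit_one_add_doubling.mul_left_cancel ?_
  have h1 : (1 + doubling) * (matZ : ColFin) = (matZ : ColFin) * divisorMatrix := by
    rw [add_mul, doubling_mul_matZ, one_mul]
    have : (matZ : ColFin) * (divisorMatrix - 1) = matZ * divisorMatrix - matZ * 1 := mul_sub (α := ColFin) _ _ _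
    rw [this, mul_one]
    exact add_sub_cancel (matZ : ColFin) _
  have h2 : divisorMatrix * doubling = (divisorMatrix - 1) - oddDivisors := by
    rw [oddDivisors, commute_divisorMatrix_doubling.eq]
    abel
  have h3 : (matZ : ColFin) * (divisorMatrix - 1 - oddDivisors) =
    matZ * (divisorMatrix - 1) - matZ * oddDivisors := mul_sub (α := ColFin) _ _ _
  have h4 : (doubling - oddDivisors) * (matZ : ColFin) =
    doubling * matZ - oddDivisors * matZ := sub_mul (α := ColFin) _ _ _
  rw [← mul_assoc, h1, mul_assoc, h2, h3, ← doubling_mul_matZ,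
    ← commute_oddDivisors_matZ.eq, ← mul_assoc, one_add_doubling_mul_signedDivisors, h4]

/-- By `matZ_mul_doubling`, `doubling ^ k * Z⁻¹ = Z⁻¹ * signedDivisors ^ k`, and the rows of `Z⁻¹`
of odd index are unit rows. So `Z⁻¹` has the shape of `Z`, with `signedDivisors` in place of `D -
1`. -/
theorem inv_matZ_row (i : ℕ+) : entry ((matZ⁻¹ : ColFinˣ) : ColFin) i =
    entry (signedDivisors ^ v2 i) (oddPart i) := by
  have h1 : SemiconjBy (matZ : ColFin) doubling signedDivisors := matZ_mul_doubling
  have h2 := h1.units_inv_symm_left.pow_right (v2 i)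
  rw [← doubling_pow_v2_mul, ← h2.eq, entry_mul_of_row_single]
  exact entry_inv_row (matZ_row_of_odd (not_two_dvd_oddPart i))

/-! ### Growth of `Z` and its inverse -/

/-- Writing `m = n / d` with `d ≥ 2` reduces this to `∑ 1/d^2 ≤ 1` over `d ≥ 2`, a telescoping
estimate. It makes `j^2` an admissible weight in `norm_entry_pow_le`. -/
theorem sum_properDivisors_sq_le (n : ℕ) : ∑ m ∈ n.properDivisors, (m : ℝ) ^ 2 ≤ (n : ℝ) ^ 2 := by
  rcases Nat.eq_zero_or_pos n with rfl | hn
  · simp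
  have hm : ∀ m ∈ n.properDivisors, n / (n / m) = m := fun m hm =>
    Nat.div_div_self (Nat.mem_properDivisors.mp hm).1 hn.ne'
  have h1 : ∑ m ∈ n.properDivisors, (m : ℝ) ^ 2 =
      ∑ d ∈ n.properDivisors.image (n / ·), ((n / d : ℕ) : ℝ) ^ 2 := by
    rw [Finset.sum_image]
    · exact Finset.sum_congr rfl fun m h => by rw [hm m h]
    · intro a ha b hb hab
      rw [← hm a ha, ← hm b hb, show n / a = n / b from hab]
  have h2 : n.properDivisors.image (n / ·) ⊆ Finset.Ioc 1 n := by
    intro d hd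
    obtain ⟨m, hmem, rfl⟩ := Finset.mem_image.mp hd
    obtain ⟨hdvd, hlt⟩ := Nat.mem_properDivisors.mp hmem
    have hm0 : 0 < m := Nat.pos_of_dvd_of_pos hdvd hn
    refine Finset.mem_Ioc.mpr ⟨?_, Nat.div_le_self _ _⟩
    obtain ⟨c, rfl⟩ := hdvd
    rw [Nat.mul_div_cancel_left _ hm0]
    by_contra hc
    have : m * c ≤ m * 1 := Nat.mul_le_mul_left _ (not_lt.mp hc)
    omega
  rw [h1]
  calc _ ≤ ∑ d ∈ Finset.Ioc 1 n, ((n / d : ℕ) : ℝ) ^ 2 :=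
        Finset.sum_le_sum_of_subset_of_nonneg h2 fun _ _ _ => by positivity
    _ ≤ ∑ d ∈ Finset.Ioc 1 n, (n : ℝ) ^ 2 * ((d : ℝ) ^ 2)⁻¹ :=
        Finset.sum_le_sum fun d _ => by
          rw [← div_eq_mul_inv, ← div_pow]
          exact pow_le_pow_left₀ (Nat.cast_nonneg _) Nat.cast_div_le 2
    _ ≤ (n : ℝ) ^ 2 * ((1 : ℕ) : ℝ)⁻¹ := by
        rw [← Finset.mul_sum]
        gcongr
        exact (sum_Ioc_inv_sq_le_sub one_ne_zero hn).trans (sub_le_self _ (by positivity))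
    _ = _ := by simp

theorem norm_entry_pow_le_sq {A : ColFin} (h0 : ∀ i j, entry A i j ≠ 0 → i ∣ j ∧ i ≠ j)
    (h1 : ∀ i j, ‖entry A i j‖ ≤ 1) (k : ℕ) (i j : ℕ+) :
    ‖entry (A ^ k) i j‖ ≤ (j : ℝ) ^ 2 := by
  have hinj : ∀ s : Set ℕ+, Set.InjOn (fun m : ℕ+ => (m : ℕ)) s := fun _ =>
    PNat.coe_injective.injOn
  refine norm_entry_pow_le (φ := fun j => (j : ℝ) ^ 2) (fun j => one_le_pow₀ (one_le_cast j))
    (fun j => (j : ℕ).properDivisors.preimage (fun m : ℕ+ => (m : ℕ)) (hinj _)) (fun m j hm => ?_)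
    (fun j => ?_) k i j
  · obtain ⟨hd, hne⟩ := h0 m j hm
    have hd' := PNat.dvd_iff.mp hd
    rw [Finset.mem_preimage, Nat.mem_properDivisors]
    exact ⟨hd', lt_of_le_of_ne (Nat.le_of_dvd j.pos hd') fun h => hne (PNat.coe_injective h)⟩
  · refine le_trans (Finset.sum_le_sum fun m _ => mul_le_of_le_one_right (by positivity) (h1 m j)) ?_
    rw [Finset.sum_preimage _ _ (hinj _) (fun m : ℕ => (m : ℝ) ^ 2)]
    · exact sum_properDivisors_sq_le j
    · intro m hm hm'
      refine absurd ⟨⟨m, ?_⟩, rfl⟩ hm'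
      exact Nat.pos_of_dvd_of_pos (Nat.mem_properDivisors.mp hm).1 j.pos

theorem mem_DR0_of_upper {A : ColFin} (h0 : ∀ i j, j < i → entry A i j = 0)
    (h1 : ∀ i j, ‖entry A i j‖ ≤ (j : ℝ) ^ 2) : A ∈ DR0 := by
  refine ⟨1, 2, one_pos, two_pos, fun i j hij => h0 i j ?_, fun i j => ?_⟩
  · rw [one_mul, Real.rpow_two] at hij
    have h2 : (j : ℝ) ≤ (j : ℝ) ^ 2 := le_self_pow₀ (one_le_cast j) two_ne_zero
    have h3 : (j : ℝ) < i := h2.trans_lt hij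
    exact_mod_cast h3
  · rw [one_mul, Real.rpow_two]; exact h1 i j

theorem entry_divisorMatrix_sub_one (i j : ℕ+) :
    entry (divisorMatrix - 1) i j = if i ∣ j ∧ i ≠ j then 1 else 0 := by
  rw [entry_sub, entry_divisorMatrix, entry_one]
  by_cases h : i = j
  · subst h; simp
  · simp [h]

theorem matZ_mem_DR0 : (matZ : ColFin) ∈ DR0 := by
  refine mem_DR0_of_upper matZ_upper.1 fun i j => ?_
  rw [matZ_row]
  refine norm_entry_pow_le_sq (fun i j h => ?_) (fun i j => ?_) _ _ _
  · rw [entry_divisorMatrix_sub_one] at h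
    by_contra hn
    exact h (if_neg hn)
  · rw [entry_divisorMatrix_sub_one]
    split_ifs <;> simp

theorem inv_matZ_mem_DR0 : ((matZ⁻¹ : ColFinˣ) : ColFin) ∈ DR0 := by
  refine mem_DR0_of_upper (fun i j => entry_inv_of_lt matZ_upper) fun i j => ?_
  rw [inv_matZ_row]
  refine norm_entry_pow_le_sq (fun i j h => ?_) (fun i j => ?_) _ _ _
  · rw [entry_signedDivisors] at h
    by_contra hn
    exact h (if_neg hn)
  · rw [entry_signedDivisors]
    split_ifs <;> simp

theorem matZ_mem_integerMatrices : (matZ : ColFin) ∈ integerMatrices := by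
  have h : divisorMatrix - 1 ∈ integerMatrices := fun i j => by
    rw [entry_divisorMatrix_sub_one]
    exact ⟨if i ∣ j ∧ i ≠ j then 1 else 0, by split_ifs <;> simp⟩
  intro i j
  rw [matZ_row]
  exact pow_mem h _ _ j

/-! ### Extending representations from `SL(2, ℤ)` to `GL(2, ℤ)` -/

/-- `S` and `T` generate `SL(2,Z)` even as a monoid, since their inverses are positive words. This
form is needed because `expGrowth` and `integerMatrices` are not given as closed under inverses. -/
theorem closure_S_T :
    Submonoid.closure ({ModularGroup.S, ModularGroup.T} : Set SL(2, ℤ)) = ⊤ := by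
  set M := Submonoid.closure ({ModularGroup.S, ModularGroup.T} : Set SL(2, ℤ)) with hM
  have hS : ModularGroup.S ∈ M := Submonoid.subset_closure (by simp)
  have hT : ModularGroup.T ∈ M := Submonoid.subset_closure (by simp)
  have iS : (ModularGroup.S : SL(2, ℤ))⁻¹ = ModularGroup.S ^ 3 := by decide
  have iT : (ModularGroup.T : SL(2, ℤ))⁻¹ =
      ModularGroup.S ^ 3 * ModularGroup.T * ModularGroup.S * ModularGroup.T * ModularGroup.S := by
    decide
  rw [eq_top_iff]
  rintro Y -
  have hY : Y ∈ Subgroup.closure {ModularGroup.S, ModularGroup.T} := by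
    rw [SpecialLinearGroup.SL2Z_generators]; trivial
  induction hY using Subgroup.closure_induction_left with
  | one => exact one_mem _
  | mul_left y hy z _ ih => exact mul_mem (Submonoid.subset_closure hy) ih
  | inv_mul_cancel y hy z _ ih =>
    refine mul_mem ?_ ih
    rcases hy with rfl | rfl
    · rw [iS]; exact pow_mem hS 3
    · rw [iT]
      exact mul_mem (mul_mem (mul_mem (mul_mem (pow_mem hS 3) hT) hS) hT) hS

theorem map_mem_of_generators {M : Type*} [Monoid M] (f : SL(2, ℤ) →* M) (N : Submonoid M)
    (hS : f ModularGroup.S ∈ N) (hT : f ModularGroup.T ∈ N) (Y : SL(2, ℤ)) : f Y ∈ N := by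
  have h : Submonoid.closure ({ModularGroup.S, ModularGroup.T} : Set SL(2, ℤ)) ≤ N.comap f := by
    rw [Submonoid.closure_le]
    rintro _ (rfl | rfl)
    · exact hS
    · exact hT
  rw [closure_S_T] at h
  exact h (Submonoid.mem_top Y)

theorem elemW_mul_self : elemW * elemW = 1 := Units.ext (by decide)

theorem det_elemW : (elemW : Matrix (Fin 2) (Fin 2) ℤ).det = -1 := by decide

/-- Conjugation by `W` on `SL(2, ℤ)`. -/
def conjW : SL(2, ℤ) →* SL(2, ℤ) where
  toFun Y := ⟨elemW.1 * Y.1 * elemW.1, by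
    rw [Matrix.det_mul, Matrix.det_mul, det_elemW, Y.2]; norm_num⟩
  map_one' := by
    apply Subtype.ext
    change elemW.1 * 1 * elemW.1 = 1
    rw [mul_one]
    exact elemW.val_inv
  map_mul' X Y := by
    have h : elemW.1 * elemW.1 = 1 := elemW.val_inv
    apply Subtype.ext
    change elemW.1 * (X.1 * Y.1) * elemW.1 = elemW.1 * X.1 * elemW.1 * (elemW.1 * Y.1 * elemW.1)
    simp only [mul_assoc]
    rw [← mul_assoc elemW.1 elemW.1 (Y.1 * elemW.1), h, one_mul]

theorem elemW_mul_coe (Y : SL(2, ℤ)) :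
    elemW * (Y : GL (Fin 2) ℤ) = (conjW Y : GL (Fin 2) ℤ) * elemW := by
  have h : (conjW Y : GL (Fin 2) ℤ) = elemW * (Y : GL (Fin 2) ℤ) * elemW := Units.ext rfl
  rw [h, mul_assoc, elemW_mul_self, mul_one]

theorem eq_coe_or_eq_coe_mul_elemW (Y : GL (Fin 2) ℤ) :
    (∃ A : SL(2, ℤ), Y = A) ∨ ∃ A : SL(2, ℤ), Y = A * elemW := by
  rcases Int.isUnit_iff.mp (Matrix.isUnits_det_units Y) with h | h
  · exact Or.inl ⟨⟨Y.1, h⟩, Units.ext rfl⟩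
  · obtain ⟨A, hA⟩ : ∃ A : SL(2, ℤ), (A : GL (Fin 2) ℤ) = Y * elemW :=
      ⟨⟨(Y * elemW).1, by rw [Units.val_mul, Matrix.det_mul, h, det_elemW]; norm_num⟩,
        Units.ext rfl⟩
    exact Or.inr ⟨A, by rw [hA, mul_assoc, elemW_mul_self, mul_one]⟩

theorem coe_ne_coe_mul_elemW (A B : SL(2, ℤ)) :
    (A : GL (Fin 2) ℤ) ≠ (B : GL (Fin 2) ℤ) * elemW := by
  intro h
  have h1 := congrArg (fun Y : GL (Fin 2) ℤ => (Y : Matrix (Fin 2) (Fin 2) ℤ).det) h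
  simp only [Units.val_mul, Matrix.det_mul, det_elemW] at h1
  have hA : ((A : GL (Fin 2) ℤ) : Matrix (Fin 2) (Fin 2) ℤ).det = 1 := A.2
  have hB : ((B : GL (Fin 2) ℤ) : Matrix (Fin 2) (Fin 2) ℤ).det = 1 := B.2
  rw [hA, hB] at h1
  norm_num at h1

/-- A homomorphism from `SL(2, ℤ)` extends to `GL(2, ℤ)` once an involution inducing the
conjugation by `W` on its image is given. -/
theorem exists_extension {H : Type*} [Group H] (f : SL(2, ℤ) →* H) (w : H) (hw : w * w = 1)
    (h : ∀ Y, f Y * w = w * f (conjW Y)) :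
    ∃ F : GL (Fin 2) ℤ →* H, (∀ Y : SL(2, ℤ), F Y = f Y) ∧ F elemW = w := by
  have h' : ∀ Y, w * f Y = f (conjW Y) * w := fun Y => by
    have := congrArg (fun x => w * x * w) (h Y)
    simp only [mul_assoc, hw, mul_one] at this
    rw [this, ← mul_assoc w w, hw, one_mul]
  -- The graph of the extension: each element of `GL(2,Z)` is `A` or `A * W` for a unique `A`, the
  -- determinant deciding which.
  set R : GL (Fin 2) ℤ → H → Prop := fun Y x =>
    (∃ A : SL(2, ℤ), Y = A ∧ x = f A) ∨ ∃ A : SL(2, ℤ), Y = A * elemW ∧ x = f A * w with hR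
  have hex : ∀ Y, ∃ x, R Y x := fun Y => by
    rcases eq_coe_or_eq_coe_mul_elemW Y with ⟨A, hA⟩ | ⟨A, hA⟩
    · exact ⟨_, Or.inl ⟨A, hA, rfl⟩⟩
    · exact ⟨_, Or.inr ⟨A, hA, rfl⟩⟩
  have huniq : ∀ {Y x y}, R Y x → R Y y → x = y := by
    rintro Y x y (⟨A, rfl, rfl⟩ | ⟨A, rfl, rfl⟩) (⟨B, hB, rfl⟩ | ⟨B, hB, rfl⟩)
    · rw [Matrix.SpecialLinearGroup.toGL_injective hB]
    · exact absurd hB (coe_ne_coe_mul_elemW A B)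
    · exact absurd hB.symm (coe_ne_coe_mul_elemW B A)
    · rw [Matrix.SpecialLinearGroup.toGL_injective (mul_right_cancel hB)]
  have hmul : ∀ {X Y x y}, R X x → R Y y → R (X * Y) (x * y) := by
    rintro X Y x y (⟨A, rfl, rfl⟩ | ⟨A, rfl, rfl⟩) (⟨B, rfl, rfl⟩ | ⟨B, rfl, rfl⟩)
    · exact Or.inl ⟨A * B, by rw [map_mul], by rw [map_mul]⟩
    · exact Or.inr ⟨A * B, by rw [map_mul, mul_assoc], by rw [map_mul, mul_assoc]⟩
    · exact Or.inr ⟨A * conjW B, by rw [map_mul, mul_assoc, elemW_mul_coe, mul_assoc],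
        by rw [map_mul, mul_assoc, h', mul_assoc]⟩
    · refine Or.inl ⟨A * conjW B, ?_, ?_⟩
      · rw [map_mul, mul_assoc, ← mul_assoc elemW, elemW_mul_coe, mul_assoc, elemW_mul_self,
          mul_one]
      · rw [map_mul, mul_assoc, ← mul_assoc w, h', mul_assoc, hw, mul_one]
  choose F hF using hex
  refine ⟨MonoidHom.mk' F fun X Y => huniq (hF _) (hmul (hF X) (hF Y)),
    fun Y => huniq (hF _) (Or.inl ⟨Y, rfl, rfl⟩), huniq (hF _) (Or.inr ⟨1, ?_, ?_⟩)⟩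
  · rw [map_one, one_mul]
  · rw [map_one, one_mul]

/-- The matrix `W(t)` as an element of `GL(2, ℂ⟦t⟧)`. -/
noncomputable def unitWt : GL (Fin 2) ℂ⟦X⟧ := ⟨Wt, Wt, Wt_mul_self, Wt_mul_self⟩

theorem conjW_S : conjW ModularGroup.S = ModularGroup.S ^ 3 := by decide

theorem conjW_T :
    conjW ModularGroup.T = ModularGroup.T * ModularGroup.S * ModularGroup.T := by decide

/-- The elements `Y` with `f Y * w = w * f (conjW Y)` form a submonoid, so the two generators
suffice. -/
theorem exists_extension_liftSL : ∃ F : GL (Fin 2) ℤ →* GL (Fin 2) ℂ⟦X⟧,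
    (∀ Y : SL(2, ℤ), F Y = Matrix.SpecialLinearGroup.toGL (liftSL St Jt St_pow St_sq_eq Y)) ∧
      F elemW = unitWt := by
  set f := Matrix.SpecialLinearGroup.toGL.comp (liftSL St Jt St_pow St_sq_eq) with hf
  refine exists_extension f unitWt (Units.ext Wt_mul_self) fun Y => ?_
  have hY : Y ∈ Submonoid.closure ({ModularGroup.S, ModularGroup.T} : Set SL(2, ℤ)) := by
    rw [closure_S_T]; trivial
  induction hY using Submonoid.closure_induction with
  | mem Y hY =>
    rcases hY with rfl | rfl
    · rw [conjW_S, map_pow, hf, MonoidHom.comp_apply, liftSL_S, ← map_pow]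
      exact Units.ext St_mul_Wt
    · rw [conjW_T, map_mul, map_mul, hf, MonoidHom.comp_apply, MonoidHom.comp_apply, liftSL_S,
        liftSL_T, ← map_mul, ← map_mul]
      exact Units.ext Jt_mul_Wt
  | one => simp
  | mul X Y _ _ hX hY => rw [map_mul, map_mul, map_mul, mul_assoc, hY, ← mul_assoc, hX, mul_assoc]

/-! ### Images of the representations -/

theorem tau1_S : (tau1 ModularGroup.S : ColFin) = gammaInv St.1 := by
  rw [tau1, MonoidHom.comp_apply, liftSL_S]; rfl

theorem tau1_T : (tau1 ModularGroup.T : ColFin) = gammaInv Jt' + 1 := by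
  rw [tau1, MonoidHom.comp_apply, liftSL_T, ← map_one gammaInv, ← map_add, ← Jt_eq]; rfl

theorem tau1_mem_integerMatrices (Y : SL(2, ℤ)) : (tau1 Y : ColFin) ∈ integerMatrices := by
  refine map_mem_of_generators ((Units.coeHom ColFin).comp tau1) integerMatrices.toSubmonoid ?_ ?_ Y
  · change (tau1 ModularGroup.S : ColFin) ∈ integerMatrices
    rw [tau1_S]; exact gammaInv_St_mem_integerMatrices
  · change (tau1 ModularGroup.T : ColFin) ∈ integerMatrices
    rw [tau1_T]; exact add_mem gammaInv_Jt'_mem_integerMatrices (one_mem _)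

theorem tau1_mem_expGrowth (Y : SL(2, ℤ)) : (tau1 Y : ColFin) ∈ expGrowth := by
  refine map_mem_of_generators ((Units.coeHom ColFin).comp tau1) expGrowth ?_ ?_ Y
  · change (tau1 ModularGroup.S : ColFin) ∈ expGrowth
    rw [tau1_S]
    refine gammaInv_mem_expGrowth fun a b => ?_
    fin_cases a <;> fin_cases b <;> simp [St]
  · change (tau1 ModularGroup.T : ColFin) ∈ expGrowth
    rw [tau1_T, ← map_one gammaInv, ← map_add]
    refine gammaInv_mem_expGrowth fun a b => add_mem (Jt'_mem_expBounded a b) ?_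
    rw [Matrix.one_apply]
    split_ifs <;> simp

/-- The matrix `A` reappears inside `psi A` in the rows and columns indexed by powers of `2`. -/
theorem isIntegerMatrix_of_psi {A : ColFin} (h : IsIntegerMatrix (psi A)) : IsIntegerMatrix A := by
  intro i j
  obtain ⟨k, hk1, hk2⟩ := exists_oddPart_v2 1 i.natPred
  obtain ⟨l, hl1, hl2⟩ := exists_oddPart_v2 1 j.natPred
  have he : entry (psi A) k l = psiEntry A k l := entry_ofMatrix _ _ k l
  have hkl := h k l
  rwa [he, psiEntry, if_pos (hk1.trans hl1.symm), hk2, hl2, PNat.succPNat_natPred,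
    PNat.succPNat_natPred] at hkl

end DivisorMatrix

/-! ### Assembly of the proposition -/

theorem mainTheorem7 :
    (Wt * Wt = 1 ∧ Wt.map PowerSeries.constantCoeff = !![0, 1; 1, 0] ∧
      ∃ C : ℝ, ∀ (i j : Fin 2) (n : ℕ),
        ‖PowerSeries.coeff n (Wt i j)‖ ≤ (2 : ℝ) ^ (C * (n : ℝ))) ∧
    ∃ (τ₁' τ' : GL (Fin 2) ℤ →* ColFinˣ) (ρ' : GL (Fin 2) ℤ →* DR0ˣ),
      (∀ Y : SL(2, ℤ), τ₁' (Y : GL (Fin 2) ℤ) = tau1 Y ∧ τ' (Y : GL (Fin 2) ℤ) = tau Y ∧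
        ((ρ' (Y : GL (Fin 2) ℤ) : DR0) : ColFin) = rho Y) ∧
      (τ₁' elemW : ColFin) = gammaInv Wt ∧
      (∀ Y : GL (Fin 2) ℤ, τ' Y = matP * τ₁' Y * matP⁻¹) ∧
      (∀ Y : GL (Fin 2) ℤ, ((ρ' Y : DR0) : ColFin) = (matZ⁻¹ : ColFinˣ) * psi (τ' Y) * matZ) ∧
      (∀ Y : GL (Fin 2) ℤ, (Y : Matrix (Fin 2) (Fin 2) ℤ).det = -1 →
        ¬ IsIntegerMatrix (τ₁' Y) ∧ ¬ IsIntegerMatrix (τ' Y) ∧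
          ¬ IsIntegerMatrix ((ρ' Y : DR0) : ColFin)) := by
  refine ⟨⟨Wt_mul_self, Wt_constantCoeff, Wt_growth⟩, ?_⟩
  obtain ⟨F, hF, hFW⟩ := exists_extension_liftSL
  set τ₁' : GL (Fin 2) ℤ →* ColFinˣ := (Units.map gammaInv.toMonoidHom).comp F with hτ₁'
  have h1 : ∀ Y : SL(2, ℤ), τ₁' (Y : GL (Fin 2) ℤ) = tau1 Y := fun Y => by
    rw [hτ₁', MonoidHom.comp_apply, hF]; rfl
  have hW : (τ₁' elemW : ColFin) = gammaInv Wt := by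
    rw [hτ₁', MonoidHom.comp_apply, hFW]; rfl
  set τ' : GL (Fin 2) ℤ →* ColFinˣ := (MulAut.conj matP).toMonoidHom.comp τ₁' with hτ'
  have hτ : ∀ Y, τ' Y = matP * τ₁' Y * matP⁻¹ := fun Y => rfl
  set r : GL (Fin 2) ℤ →* ColFinˣ :=
    ((MulAut.conj matZ⁻¹).toMonoidHom.comp (Units.map psi.toMonoidHom)).comp τ' with hr
  have hρ : ∀ Y, (r Y : ColFin) = (matZ⁻¹ : ColFinˣ) * psi (τ' Y) * matZ := fun Y => by
    change ((matZ⁻¹ * Units.map psi.toMonoidHom (τ' Y) * matZ⁻¹⁻¹ : ColFinˣ) : ColFin) = _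
    rw [inv_inv]; rfl
  have hexp : ∀ Y, (τ₁' Y : ColFin) ∈ expGrowth := fun Y => by
    rcases eq_coe_or_eq_coe_mul_elemW Y with ⟨A, rfl⟩ | ⟨A, rfl⟩
    · rw [h1]; exact tau1_mem_expGrowth A
    · rw [map_mul, Units.val_mul, h1, hW]
      exact mul_mem (tau1_mem_expGrowth A) (gammaInv_mem_expGrowth Wt_mem_expBounded)
  have hDR : ∀ Y, (r Y : ColFin) ∈ DR0 := fun Y => by
    rw [hρ]
    refine mul_mem (mul_mem inv_matZ_mem_DR0 (psi_mem_DR0 ?_)) matZ_mem_DR0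
    exact mul_mem (mul_mem matP_mem_expGrowth (hexp Y)) inv_matP_mem_expGrowth
  have hint1 : ∀ Y : GL (Fin 2) ℤ, (Y : Matrix (Fin 2) (Fin 2) ℤ).det = -1 →
      (τ₁' Y : ColFin) ∉ integerMatrices := fun Y hY h => by
    rcases eq_coe_or_eq_coe_mul_elemW Y with ⟨A, rfl⟩ | ⟨A, rfl⟩
    · have hA : ((A : GL (Fin 2) ℤ) : Matrix (Fin 2) (Fin 2) ℤ).det = 1 := A.2
      rw [hA] at hY
      norm_num at hY
    -- If `τ₁(AW)` were integral, so would be its product `τ₁(W)` with the integral matrix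
    -- `τ₁(A⁻¹)`.
    · have e : (tau1 A⁻¹ : ColFin) * (τ₁' (A * elemW) : ColFin) = gammaInv Wt := by
        rw [← hW, ← Units.val_mul, map_mul, h1, ← mul_assoc, ← map_mul, inv_mul_cancel, map_one,
          one_mul]
      exact not_isIntegerMatrix_gammaInv_Wt (e ▸ mul_mem (tau1_mem_integerMatrices A⁻¹) h)
  have hint2 : ∀ Y : GL (Fin 2) ℤ, (Y : Matrix (Fin 2) (Fin 2) ℤ).det = -1 →
      (τ' Y : ColFin) ∉ integerMatrices := fun Y hY h => by
    have hP := matP_mem_integerMatrices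
    have e : ((matP⁻¹ : ColFinˣ) : ColFin) * (τ' Y : ColFin) * matP = τ₁' Y := by
      rw [← Units.val_mul, ← Units.val_mul, hτ]
      congr 1
      group
    exact hint1 Y hY (e ▸ mul_mem (mul_mem (inv_mem_integerMatrices matP_upper hP) h) hP)
  -- A monoid homomorphism from a group into `DR0` takes values in units of `DR0`, so membership of
  -- inverses needs no separate check.
  refine ⟨τ₁', τ', (((Units.coeHom ColFin).comp r).codRestrict DR0 hDR).toHomUnits,
    fun Y => ⟨h1 Y, ?_, ?_⟩, hW, hτ, hρ, fun Y hY => ⟨hint1 Y hY, hint2 Y hY, fun h => ?_⟩⟩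
  · rw [hτ, h1]; rfl
  · change (r (Y : GL (Fin 2) ℤ) : ColFin) = rho Y
    have : τ' (Y : GL (Fin 2) ℤ) = tau Y := by rw [hτ, h1]; rfl
    rw [hr, MonoidHom.comp_apply, this]; rfl
  · have h' : (r Y : ColFin) ∈ integerMatrices := h
    have hZ := matZ_mem_integerMatrices
    have e : (matZ : ColFin) * (r Y : ColFin) * (matZ⁻¹ : ColFinˣ) = psi (τ' Y) := by
      rw [hρ]
      simp only [mul_assoc, Units.mul_inv_cancel_left, Units.mul_inv, mul_one]
    exact hint2 Y hY (isIntegerMatrix_of_psi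
      (e ▸ mul_mem (mul_mem hZ h') (inv_mem_integerMatrices matZ_upper hZ)))
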